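/- All manifolds are smooth, finite-dimensional, Hausdorff, second countable and without boundary. **Setting.** Let $(Z,\varpi)$ be a Poisson manifold, with $\{f,g\}=\varpi(df,dg)$ and $X_f=\varpi^\sharp\circ df$, so that $\{f,g\}=X_g\cdot f$. Let $S\subset Z$ be a symplectic leaf which is an embedded submanifold, with symplectic form $\omega_S$, and let $X\subset S$ be an embedded Lagrangian submanifold of $(S,\omega_S)$. Let $i_Q:Q\to Z$ be the inclusion of a locally closed (embedded) coisotropic submanifold with $S\subset Q$; coisotropic means $\varpi|_{(TQ)^0}=0$, where $(\cdot)^0$ denotes annihilators. Let $\mathfrak C=\{f\in C^\infty(Z): f|_Q=0\}$, let $\mathfrak N=\{g\in C^\infty(Z):\{g,\mathfrak C\}\subset\mathfrak C\}$ be its idealizer, and let $\mathcal C$ be the foliation of $Q$ tangent to $\varpi^\sharp((TQ)^0)\subset TQ$. **Sternberg–Weinstein approximation.** Let $E_X=(TX)^0\subset T^*Z|_X$ and $Z'=E_X^*=TZ|_X/TX$ with projection $\tau:Z'\to X$; for a section $s$ of $E_X$, or of $S^2(E_X)$, let $\bar s\in C^\infty(Z')$ be the fibrewise linear function, or the fibrewise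 quadratic function $\bar s(t)=s(t,t)$, that it defines. $C^\infty(Z')$ carries the Poisson bracket $\{\cdot,\cdot\}'$ which is determined by being a biderivation with $$\{\tau^*(f|_X),\tau^*(g|_X)\}'=0,\qquad \{\overline{dh|_X},\tau^*(g|_X)\}'=\tau^*(\{h,g\}|_X),\qquad \{\overline{dh|_X},\overline{dk|_X}\}'=\overline{d\{h,k\}|_X}$$ for all $f,g,h,k\in C^\infty(Z)$ with $h|_X=k|_X=0$. Put $\tilde E_X=(TX)^0\subset T^*Q|_X$ and $Q'=\tilde E_X^*=TQ|_X/TX$, with the inclusion $i_{Q'}:Q'\to Z'$ induced by $Ti_Q$; for a section $s$ of $S^2(\tilde E_X)$ let $\bar s\in C^\infty(Q')$ be defined as before. Let $\mathfrak C'=\{F\in C^\infty(Z'):F|_{Q'}=0\}$, let $\mathfrak N'=\{F\in C^\infty(Z'):\{F,\mathfrak C'\}'\subset\mathfrak C'\}$, and let $\tilde{\mathfrak P}'=i_{Q'}^*\mathfrak N'$. **Second-order term.** If $M$ is $Z$ or $Q$ and $K\in C^\infty(M)$ satisfies $dK|_X=0$, let $\mathrm{Hess}\,K$ be the field of bilinear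 forms on $TM|_X$ given by $pr_2\circ T(dK):TM|_X\to T^*M|_X$, where $pr_2$ is the projection for the natural splitting $T(T^*M)=TM\oplus T^*M$ along the zero section (the second derivative of $K$ at its critical points). **Theorem.** Let $\tilde H\in C^\infty(Q)$ with $d\tilde H|_X=0$. 1. There is a unique smooth section $j^V\tilde H$ of $S^2(\tilde E_X)$, i.e. a smooth field of symmetric bilinear forms on the fibres of $\tilde E_X^*=TQ|_X/TX$, such that $(j^V\tilde H)([u],[v])=\mathrm{Hess}\,\tilde H(u,v)$ for all $x\in X$ and $u,v\in T_xQ$. Put $\tilde H_2'=\overline{j^V\tilde H}\in C^\infty(Q')$. 2. If $\tilde H=i_Q^*H$ with $H\in C^\infty(Z)$ and $dH|_X=0$, then $\mathrm{Hess}\,H$ likewise induces a smooth section $j^VH$ of $S^2(E_X)$, and with $H_2'=\overline{j^VH}\in C^\infty(Z')$ one has $\tilde H_2'=i_{Q'}^*H_2'$. 3. If $\tilde H$ is admissible, that is, if $\tilde H$ is constant on the leaves of $\mathcal C$ or if $\tilde H\in i_Q^*\mathfrak N$, then $\tilde H_2'\in\tilde{\mathfrak P}'$. -/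

import Mathlib

open scoped Manifold ContDiff Bundle
open Bundle Set

noncomputable section

namespace SternbergWeinstein

section Basic

variable {E : Type*} [NormedAddCommGroup E] [NormedSpace ℝ E]
  {M : Type*} [TopologicalSpace M] [ChartedSpace E M]

/-- The algebra `C^∞(M)` of smooth real functions on a manifold `M` modelled on `E`. -/
abbrev SmoothFn (E : Type*) [NormedAddCommGroup E] [NormedSpace ℝ E]
    (M : Type*) [TopologicalSpace M] [ChartedSpace E M] : Type _ :=
  C^∞⟮𝓘(ℝ, E), M; 𝓘(ℝ, ℝ), ℝ⟯

/-- The cotangent space of `M` at `z`. -/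
abbrev Cotangent (E : Type*) [NormedAddCommGroup E] [NormedSpace ℝ E]
    {M : Type*} [TopologicalSpace M] [ChartedSpace E M] (z : M) : Type _ :=
  TangentSpace 𝓘(ℝ, E) z →L[ℝ] ℝ

/-- The differential `df_z` of a smooth function. -/
def dAt (f : SmoothFn E M) (z : M) : Cotangent E z :=
  mfderiv 𝓘(ℝ, E) 𝓘(ℝ, ℝ) f z

/-- A smooth bivector field `w`, given by its bundle morphism `w^♯ : T^*M → TM`;
thus `w(α, β) = α (w^♯ β)`. -/
structure BivectorField (E : Type*) [NormedAddCommGroup E] [NormedSpace ℝ E]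
    (M : Type*) [TopologicalSpace M] [ChartedSpace E M] where
  sharp : ∀ z : M, Cotangent E z →ₗ[ℝ] TangentSpace 𝓘(ℝ, E) z
  skew : ∀ (z : M) (α β : Cotangent E z), α (sharp z β) = -β (sharp z α)
  smooth : ∀ f g : SmoothFn E M,
    ContMDiff 𝓘(ℝ, E) 𝓘(ℝ, ℝ) ∞ fun z => dAt f z (sharp z (dAt g z))

/-- The bracket `{f, g} = w(df, dg)`. -/
def BivectorField.bracket (w : BivectorField E M) (f g : SmoothFn E M) : SmoothFn E M :=
  ⟨fun z => dAt f z (w.sharp z (dAt g z)), w.smooth f g⟩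

/-- The Hamiltonian vector field `X_f = w^♯ ∘ df`. -/
def BivectorField.ham (w : BivectorField E M) (f : SmoothFn E M) (z : M) :
    TangentSpace 𝓘(ℝ, E) z :=
  w.sharp z (dAt f z)

/-- A Poisson structure: a bivector field whose bracket satisfies the Jacobi identity. -/
structure PoissonStructure (E : Type*) [NormedAddCommGroup E] [NormedSpace ℝ E]
    (M : Type*) [TopologicalSpace M] [ChartedSpace E M] extends BivectorField E M where
  jacobi : ∀ f g h : SmoothFn E M,
    toBivectorField.bracket f (toBivectorField.bracket g h)
      + toBivectorField.bracket g (toBivectorField.bracket h f)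
      + toBivectorField.bracket h (toBivectorField.bracket f g) = 0

/-- The Hessian of `H` at `z`: the second derivative of `H` in the preferred chart at `z`, which is
the chart through which `TangentSpace 𝓘(ℝ, E) z` is identified with `E`. In the trivialization of
`T^*M` defined by this chart it is the derivative at `z` of the section `dH`. When `dH_z = 0` it
therefore is the component `pr₂ ∘ T_z(dH) : T_zM → T_z^*M` of `T_z(dH)` in the natural splitting
`T(T^*M) = TM ⊕ T^*M` along the zero section, and does not depend on the chart. -/
def hessAt (H : SmoothFn E M) (z : M) :
    TangentSpace 𝓘(ℝ, E) z →L[ℝ] TangentSpace 𝓘(ℝ, E) z →L[ℝ] ℝ :=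
  (fderiv ℝ (fun y : E => fderiv ℝ (fun y' : E => H ((extChartAt 𝓘(ℝ, E) z).symm y')) y)
    (extChartAt 𝓘(ℝ, E) z z) : E →L[ℝ] E →L[ℝ] ℝ)

end Basic

section Submanifolds

variable {EN : Type*} [NormedAddCommGroup EN] [NormedSpace ℝ EN]
  {N : Type*} [TopologicalSpace N] [ChartedSpace EN N]
  {E : Type*} [NormedAddCommGroup E] [NormedSpace ℝ E]
  {M : Type*} [TopologicalSpace M] [ChartedSpace E M]

/-- Smooth maps `N → M`; submanifolds are given by their inclusion maps. -/
abbrev SmoothMap (EN : Type*) [NormedAddCommGroup EN] [NormedSpace ℝ EN]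
    (N : Type*) [TopologicalSpace N] [ChartedSpace EN N]
    (E : Type*) [NormedAddCommGroup E] [NormedSpace ℝ E]
    (M : Type*) [TopologicalSpace M] [ChartedSpace E M] : Type _ :=
  C^∞⟮𝓘(ℝ, EN), N; 𝓘(ℝ, E), M⟯

/-- The inclusion map of an embedded submanifold. -/
def IsSubmanifold (φ : SmoothMap EN N E M) : Prop :=
  Manifold.IsSmoothEmbedding 𝓘(ℝ, EN) 𝓘(ℝ, E) ∞ φ

/-- The tangent map `T_nφ`. -/
def tangentAt (φ : SmoothMap EN N E M) (n : N) :
    TangentSpace 𝓘(ℝ, EN) n →ₗ[ℝ] TangentSpace 𝓘(ℝ, E) (φ n) :=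
  (mfderiv 𝓘(ℝ, EN) 𝓘(ℝ, E) φ n).toLinearMap

/-- The tangent space of the submanifold `φ : N → M` at `n`, as a subspace of `T_{φ n}M`. -/
def tangentRange (φ : SmoothMap EN N E M) (n : N) :
    Submodule ℝ (TangentSpace 𝓘(ℝ, E) (φ n)) :=
  LinearMap.range (tangentAt φ n)

/-- The annihilator `(TN)^0 ⊂ T^*M` at `n`. -/
def annihilator (φ : SmoothMap EN N E M) (n : N) : Set (Cotangent E (φ n)) :=
  {α | ∀ u ∈ tangentRange φ n, α u = 0}

/-- `y` can be reached from `z` by following a Hamiltonian vector field. -/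
def HamiltonianStep (w : PoissonStructure E M) (z y : M) : Prop :=
  ∃ (f : SmoothFn E M) (γ : ℝ → M),
    IsMIntegralCurveOn (I := 𝓘(ℝ, E)) γ (w.ham f) (Icc 0 1) ∧ γ 0 = z ∧ γ 1 = y

/-- The inclusion `φ : N → M` of a symplectic leaf: an embedded integral manifold of the
distribution `w^♯(T^*M)` which is maximal, i.e. it consists of all points that can be reached from
one (equivalently, any) of its points by piecewise Hamiltonian curves. -/
structure IsSymplecticLeaf (w : PoissonStructure E M) (φ : SmoothMap EN N E M) : Prop where
  embedded : IsSubmanifold φ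
  nonempty : Nonempty N
  integral : ∀ n, tangentRange φ n = LinearMap.range (w.sharp (φ n))
  maximal : ∀ n, range φ = {y | Relation.ReflTransGen (HamiltonianStep w) (φ n) y}

/-- The inclusion `φ : N → M` of a submanifold of a symplectic leaf is Lagrangian. The symplectic
form `ω` of the leaf is determined by `ω(w^♯ α, v) = α v` for `v` tangent to the leaf, that is
`ω^♭ = (w^♯)⁻¹`; the condition says that a vector `w^♯ α` tangent to the leaf belongs to `TN` if
and only if it is `ω`-orthogonal to `TN`. -/
def IsLagrangian (w : PoissonStructure E M) (φ : SmoothMap EN N E M) : Prop :=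
  ∀ (n : N) (α : Cotangent E (φ n)),
    w.sharp (φ n) α ∈ tangentRange φ n ↔ ∀ v ∈ tangentRange φ n, α v = 0

/-- The submanifold `φ : N → M` is coisotropic: `w` vanishes on `(TN)^0`. -/
def IsCoisotropic (w : PoissonStructure E M) (φ : SmoothMap EN N E M) : Prop :=
  ∀ (n : N), ∀ α ∈ annihilator φ n, ∀ β ∈ annihilator φ n, α (w.sharp (φ n) β) = 0

/-- The constraints `{f ∈ C^∞(M) | f|_N = 0}`. -/
def constraints (φ : SmoothMap EN N E M) : Set (SmoothFn E M) :=
  {f | ∀ n, f (φ n) = 0}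

/-- The admissible functions: the idealizer of the constraints in `C^∞(M)`. -/
def admissible (w : PoissonStructure E M) (φ : SmoothMap EN N E M) : Set (SmoothFn E M) :=
  {g | ∀ f ∈ constraints φ, w.bracket g f ∈ constraints φ}

/-- The subcharacteristic distribution `w^♯((TN)^0) ∩ TN` of `N`, as a subset of `TM`. -/
def subcharacteristic (w : PoissonStructure E M) (φ : SmoothMap EN N E M) (n : N) :
    Set (TangentSpace 𝓘(ℝ, E) (φ n)) :=
  (w.sharp (φ n) '' annihilator φ n) ∩ tangentRange φ n

/-- Two points of `N` lie on the same leaf of the subcharacteristic foliation: they are joined by a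
smooth curve in `N` which is tangent to the subcharacteristic distribution. -/
def SameLeaf (w : PoissonStructure E M) (φ : SmoothMap EN N E M) (p q : N) : Prop :=
  ∃ (γ : ℝ → N) (U : Set ℝ), IsOpen U ∧ Icc 0 1 ⊆ U ∧
    ContMDiffOn 𝓘(ℝ, ℝ) 𝓘(ℝ, EN) ∞ γ U ∧
    (∀ t ∈ Icc (0 : ℝ) 1,
      tangentAt φ (γ t) (mfderiv 𝓘(ℝ, ℝ) 𝓘(ℝ, EN) γ t (1 : ℝ))
        ∈ subcharacteristic w φ (γ t)) ∧
    γ 0 = p ∧ γ 1 = q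

/-- The functions on `N` which are constant on the leaves of the subcharacteristic foliation. -/
def constantOnLeaves (w : PoissonStructure E M) (φ : SmoothMap EN N E M) :
    Set (SmoothFn EN N) :=
  {f | ∀ p q, SameLeaf w φ p q → f p = f q}

/-- The restrictions to `N` of the admissible functions. -/
def admissibleRestrictions (w : PoissonStructure E M) (φ : SmoothMap EN N E M) :
    Set (SmoothFn EN N) :=
  {f | ∃ g ∈ admissible w φ, ∀ n, f n = g (φ n)}

end Submanifolds

section Normal

variable {EX : Type*} [NormedAddCommGroup EX] [NormedSpace ℝ EX]
  {X : Type*} [TopologicalSpace X] [ChartedSpace EX X]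
  {E : Type*} [NormedAddCommGroup E] [NormedSpace ℝ E]
  {M : Type*} [TopologicalSpace M] [ChartedSpace E M]

/-- The fibre `T_{φ x}M / T_xX` of the normal bundle of the submanifold `φ : X → M`. -/
abbrev NormalSpace (φ : SmoothMap EX X E M) (x : X) : Type _ :=
  TangentSpace 𝓘(ℝ, E) (φ x) ⧸ tangentRange φ x

/-- The class of a tangent vector in the normal space. -/
def normalClass (φ : SmoothMap EX X E M) (x : X) (u : TangentSpace 𝓘(ℝ, E) (φ x)) :
    NormalSpace φ x :=
  Submodule.Quotient.mk u

/-- The total space of the normal bundle `TM|_X / TX`. -/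
abbrev NormalBundle (φ : SmoothMap EX X E M) : Type _ :=
  Σ x : X, NormalSpace φ x

/-- The total space of the pullback bundle `TM|_X`. -/
abbrev RestrictedTangent (φ : SmoothMap EX X E M) : Type _ :=
  TotalSpace E (φ *ᵖ (TangentSpace 𝓘(ℝ, E) : M → Type _))

/-- The projection `TM|_X → TM|_X / TX`, a surjective submersion. -/
def toNormal (φ : SmoothMap EX X E M) (p : RestrictedTangent φ) : NormalBundle φ :=
  ⟨p.1, normalClass φ p.1 p.2⟩

variable [IsManifold 𝓘(ℝ, E) ∞ M]

/-- The elements of `C^∞(TM|_X / TX)`: a function on the quotient bundle is smooth if and only if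
its composition with the surjective submersion `TM|_X → TM|_X / TX` is smooth. -/
def IsSmoothOnNormal (φ : SmoothMap EX X E M) (F : NormalBundle φ → ℝ) : Prop :=
  ContMDiff (𝓘(ℝ, EX).prod 𝓘(ℝ, E)) 𝓘(ℝ, ℝ) ∞ fun p : RestrictedTangent φ => F (toNormal φ p)

/-- A smooth field of symmetric bilinear forms on the fibres of the normal bundle `TM|_X / TX`,
i.e. a section of the symmetric square of its dual bundle `(TX)^0`. (Smoothness of such a field is
the same as smoothness of the corresponding fibrewise quadratic function.) -/
@[ext]
structure SymmetricField (φ : SmoothMap EX X E M) where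
  form : ∀ x : X, NormalSpace φ x →ₗ[ℝ] NormalSpace φ x →ₗ[ℝ] ℝ
  symm : ∀ x u v, form x u v = form x v u
  smooth : IsSmoothOnNormal φ fun t => form t.1 t.2 t.2

/-- The fibrewise quadratic function on the normal bundle defined by a field of symmetric forms. -/
def SymmetricField.bar {φ : SmoothMap EX X E M} (j : SymmetricField φ) (t : NormalBundle φ) : ℝ :=
  j.form t.1 t.2 t.2

/-- `j` is the field `j^V H` of symmetric bilinear forms on the fibres of `TM|_X / TX` induced by
`pr₂ ∘ T(dH)` on `TM|_X`, for a function `H` with `dH|_X = 0`. -/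
def IsVerticalJet (φ : SmoothMap EX X E M) (H : SmoothFn E M) (j : SymmetricField φ) : Prop :=
  ∀ (x : X) (u v : TangentSpace 𝓘(ℝ, E) (φ x)),
    j.form x (normalClass φ x u) (normalClass φ x v) = hessAt H (φ x) u v

/-- The function `τ^*(f|_X) + \bar{dh}|_X` on `TM|_X / TX`, composed with `TM|_X → TM|_X / TX`, for
`f ∈ C^∞(M)` and `h ∈ C^∞(M)` with `h|_X = 0`. Here `τ` is the bundle projection and the second
summand is the fibrewise linear function defined by the section `dh|_X` of `(TX)^0`. -/
def generator (φ : SmoothMap EX X E M) (f h : SmoothFn E M) (p : RestrictedTangent φ) : ℝ :=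
  f (φ p.1) + dAt h (φ p.1) p.2

/-- `F` and `τ^*(f|_X) + \bar{dh}|_X` have the same differential at the image of `p` in the normal
bundle. -/
def SameDifferential (φ : SmoothMap EX X E M) (F : NormalBundle φ → ℝ) (p : RestrictedTangent φ)
    (f h : SmoothFn E M) : Prop :=
  h ∈ constraints φ ∧
    mfderiv (𝓘(ℝ, EX).prod 𝓘(ℝ, E)) 𝓘(ℝ, ℝ) (fun r : RestrictedTangent φ => F (toNormal φ r)) p
      = mfderiv (𝓘(ℝ, EX).prod 𝓘(ℝ, E)) 𝓘(ℝ, ℝ) (generator φ f h) p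

/-- The Sternberg-Weinstein Poisson bracket `{F, G}'` on `C^∞(TM|_X / TX)`, for `X` Lagrangian in a
symplectic leaf. It is the biderivation determined by its values
`{τ^*(f|_X), τ^*(g|_X)}' = 0`, `{\bar{dh}|_X, τ^*(g|_X)}' = τ^*({h, g}|_X)`,
`{\bar{dh}|_X, \bar{dk}|_X}' = \bar{d{h, k}}|_X` on the functions `τ^*(f|_X)` and `\bar{dh}|_X`
with `h|_X = 0`, whose differentials span the cotangent space at each point (on sections of `(TX)^0`
this is the bracket of 1-forms, `{dh, dk} = d{h, k}`, with anchor `-w^♯`). Accordingly, its value at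
the class `t` of `p` is obtained by replacing `F` and `G` by functions of this family with the same
differential at `t`; it does not depend on the choices. -/
def swBracket (w : PoissonStructure E M) (φ : SmoothMap EX X E M) (F G : NormalBundle φ → ℝ)
    (t : NormalBundle φ) : ℝ :=
  Classical.epsilon fun c : ℝ =>
    ∃ (p : RestrictedTangent φ) (f h g k : SmoothFn E M), toNormal φ p = t ∧
      SameDifferential φ F p f h ∧ SameDifferential φ G p g k ∧
      c = w.bracket f k (φ p.1) + w.bracket h g (φ p.1) + dAt (w.bracket h k) (φ p.1) p.2

end Normal

section Reduced

variable {EX : Type*} [NormedAddCommGroup EX] [NormedSpace ℝ EX]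
  {X : Type*} [TopologicalSpace X] [ChartedSpace EX X]
  {EQ : Type*} [NormedAddCommGroup EQ] [NormedSpace ℝ EQ]
  {Q : Type*} [TopologicalSpace Q] [ChartedSpace EQ Q]
  {E : Type*} [NormedAddCommGroup E] [NormedSpace ℝ E]
  {M : Type*} [TopologicalSpace M] [ChartedSpace E M]

theorem tangentRange_le_comap (ι : SmoothMap EQ Q E M) (ψ : SmoothMap EX X EQ Q) (x : X) :
    tangentRange ψ x ≤ (tangentRange (ι.comp ψ) x).comap (tangentAt ι (ψ x)) := by
  rintro _ ⟨u, rfl⟩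
  refine ⟨u, ?_⟩
  have h := mfderiv_comp x (ι.contMDiff.mdifferentiableAt (x := ψ x) (by simp))
    (ψ.contMDiff.mdifferentiableAt (x := x) (by simp))
  exact congrArg (fun L => L u) h

/-- For `X ⊂ Q ⊂ M`, the inclusion `TQ|_X / TX → TM|_X / TX` induced by the inclusion of `Q`. -/
def normalInclusion (ι : SmoothMap EQ Q E M) (ψ : SmoothMap EX X EQ Q) (t : NormalBundle ψ) :
    NormalBundle (ι.comp ψ) :=
  ⟨t.1, Submodule.mapQ (tangentRange ψ t.1) (tangentRange (ι.comp ψ) t.1)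
    (tangentAt ι (ψ t.1)) (tangentRange_le_comap ι ψ t.1) t.2⟩

variable [IsManifold 𝓘(ℝ, E) ∞ M]

/-- The Sternberg-Weinstein constraint algebra: the smooth functions on `Z' = TM|_X / TX` which
vanish on `Q' = TQ|_X / TX`. -/
def swConstraints (ι : SmoothMap EQ Q E M) (ψ : SmoothMap EX X EQ Q) :
    Set (NormalBundle (ι.comp ψ) → ℝ) :=
  {G | IsSmoothOnNormal (ι.comp ψ) G ∧ ∀ t, G (normalInclusion ι ψ t) = 0}

/-- The Sternberg-Weinstein admissible functions: the idealizer of the constraint algebra in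
`C^∞(Z')`. (The bracket of smooth functions is smooth, so that it lies in the constraint algebra if
and only if it vanishes on `Q'`.) -/
def swAdmissible (w : PoissonStructure E M) (ι : SmoothMap EQ Q E M) (ψ : SmoothMap EX X EQ Q) :
    Set (NormalBundle (ι.comp ψ) → ℝ) :=
  {F | IsSmoothOnNormal (ι.comp ψ) F ∧
    ∀ G ∈ swConstraints ι ψ, ∀ t, swBracket w (ι.comp ψ) F G (normalInclusion ι ψ t) = 0}

/-- The reduced Poisson algebra of the reduced Sternberg-Weinstein approximation: the restrictions
to `Q'` of the admissible functions on `Z'`. -/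
def swReduced (w : PoissonStructure E M) (ι : SmoothMap EQ Q E M) (ψ : SmoothMap EX X EQ Q) :
    Set (NormalBundle ψ → ℝ) :=
  {f | ∃ F ∈ swAdmissible w ι ψ, ∀ t, f t = F (normalInclusion ι ψ t)}

end Reduced

end SternbergWeinstein

end

noncomputable section

namespace SternbergWeinstein

open Filter Topology

/-! ### Second and third derivatives at a critical point, in linear coordinates. -/

section Calculus

/-! At a critical point the second derivative of a function transforms tensorially, because the term
carrying the second derivative of a coordinate change is multiplied by the vanishing differential
(`hessAt_comp`). Since the differential vanishes all along X, its derivative in directions of TX is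
zero (`hessAt_tangent_left`); by symmetry TX lies in the kernel of the Hessian, which therefore
descends to the normal bundle. Naturality under the inclusion of Q (`hessAt_map`) compares the
Hessians on Q and on Z.

For the third assertion, either form of admissibility gives that the differential of the function H
on Q kills the image under w♯ of the conormal space of Q. The quadratic function on Q' is extended
to a smooth F on Z' by gluing Hessians of local extensions of H
(`exists_extension_verticalJet_bar`). It remains to see that the bracket of F with any constraint G
vanishes on Q'.

This is a computation in a chart where Q is a linear subspace (`linearized_bracket_eq_zero`). Let
(f, h) and (g, k) represent the differentials of F and G at the class of u in TQ. Because h and k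
vanish on X and X is Lagrangian, their Hamiltonian vectors at the point are tangent to X, and these
are exactly the directions in which the derivatives of f and g are controlled. The terms containing
g and the second derivative of k cancel. Those containing f and the second derivative of h combine
to D³H(b, u, u), where b is the Hamiltonian vector of k. What is left is the derivative of the
bivector in direction u, paired with dh and dk; differentiated skewness and coisotropy turn it into
2 D²H(u, DY u), where Y is the vector field obtained by applying the bivector to the constant
covector dk. Differentiating the invariance dH(Y) = 0 twice along u at the critical point says that
the sum of the two is zero (`third_derivative_of_invariant`). -/

theorem two_le_infty : (2 : WithTop ℕ∞) ≤ ∞ := by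
  simpa using WithTop.coe_le_coe.2 (le_top : (2 : ℕ∞) ≤ ⊤)

set_option synthInstance.maxHeartbeats 200000

variable {E E' : Type*} [NormedAddCommGroup E] [NormedSpace ℝ E]
  [NormedAddCommGroup E'] [NormedSpace ℝ E']

theorem contDiffAt_fderiv {F : Type*} [NormedAddCommGroup F] [NormedSpace ℝ F] {f : E → F} {x : E}
    (hf : ContDiffAt ℝ ∞ f x) : ContDiffAt ℝ ∞ (fderiv ℝ f) x :=
  hf.fderiv_right (m := ∞) (by simp)

theorem eventually_contDiffAt_two {F : Type*} [NormedAddCommGroup F] [NormedSpace ℝ F] {f : E → F}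
    {x : E} (hf : ContDiffAt ℝ ∞ f x) : ∀ᶠ y in 𝓝 x, ContDiffAt ℝ 2 f y :=
  (hf.of_le (m := 2) two_le_infty).eventually (by simp)

theorem fderiv_fderiv_symm {f : E → ℝ} {x : E} (hf : ContDiffAt ℝ 2 f x) (u v : E) :
    fderiv ℝ (fderiv ℝ f) x u v = fderiv ℝ (fderiv ℝ f) x v u :=
  (hf.isSymmSndFDerivAt (by simp)) u v

/-- The chain rule for second derivatives at a critical point. -/
theorem fderiv_fderiv_comp_of_critical {g : E → ℝ} {τ : E' → E} {y : E'}
    (hg : ContDiffAt ℝ ∞ g (τ y)) (hτ : ContDiffAt ℝ ∞ τ y) (h0 : fderiv ℝ g (τ y) = 0)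
    (u v : E') :
    fderiv ℝ (fderiv ℝ (g ∘ τ)) y u v
      = fderiv ℝ (fderiv ℝ g) (τ y) (fderiv ℝ τ y u) (fderiv ℝ τ y v) := by
  have hev : ∀ᶠ y' in 𝓝 y, fderiv ℝ (g ∘ τ) y' = (fderiv ℝ g (τ y')).comp (fderiv ℝ τ y') := by
    have h1 := eventually_contDiffAt_two hτ
    have h2 := hτ.continuousAt.eventually (eventually_contDiffAt_two hg)
    filter_upwards [h1, h2] with y' h1 h2
    exact fderiv_comp y' (h2.differentiableAt (by simp)) (h1.differentiableAt (by simp))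
  rw [EventuallyEq.fderiv_eq hev]
  have hd := (contDiffAt_fderiv hτ).differentiableAt (by simp)
  have hd2 : DifferentiableAt ℝ (fun y' => fderiv ℝ g (τ y')) y :=
    ((contDiffAt_fderiv hg).differentiableAt (by simp)).comp y (hτ.differentiableAt (by simp))
  rw [fderiv_clm_comp hd2 hd]
  have h3 : fderiv ℝ (fun y' => fderiv ℝ g (τ y')) y
      = (fderiv ℝ (fderiv ℝ g) (τ y)).comp (fderiv ℝ τ y) :=
    fderiv_comp y ((contDiffAt_fderiv hg).differentiableAt (by simp))
      (hτ.differentiableAt (by simp))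
  -- The only other term of the product rule contains the second derivative of `τ`, and it is
  -- composed with the differential of `g`, which is zero here.
  simp only [h0]
  simp [h3]

/-- Two transpositions suffice: symmetry of the second derivative of the partial derivative along
`u`, and symmetry of the second derivative of `f` at all nearby points. -/
theorem fderiv_third_symm {f : E → ℝ} {x : E} (hf : ContDiffAt ℝ ∞ f x) (u b : E) :
    fderiv ℝ (fun y => fderiv ℝ (fderiv ℝ f) y u u) x b
      = fderiv ℝ (fun y => fderiv ℝ (fderiv ℝ f) y u b) x u := by
  have h1 := contDiffAt_fderiv hf
  have h2 := contDiffAt_fderiv h1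
  have hm : ContDiffAt ℝ ∞ (fun y => fderiv ℝ f y u) x := h1.clm_apply contDiffAt_const
  have hev : ∀ᶠ y in 𝓝 x, fderiv ℝ (fun y => fderiv ℝ f y u) y
      = (fderiv ℝ (fderiv ℝ f) y).flip u := by
    filter_upwards [eventually_contDiffAt_two h1] with y hy
    ext b
    rw [fderiv_clm_apply (hy.differentiableAt (by simp)) (differentiableAt_const u)]
    simp
  have key := fderiv_fderiv_symm (hm.of_le two_le_infty) u b
  have hD : DifferentiableAt ℝ (fderiv ℝ (fun y => fderiv ℝ f y u)) x :=
    (contDiffAt_fderiv hm).differentiableAt (by simp)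
  have e1 : ∀ a c, fderiv ℝ (fderiv ℝ (fun y => fderiv ℝ f y u)) x a c
      = fderiv ℝ (fun y => fderiv ℝ (fderiv ℝ f) y c u) x a := by
    intro a c
    have : fderiv ℝ (fun y => fderiv ℝ (fun y => fderiv ℝ f y u) y c) x a
        = fderiv ℝ (fderiv ℝ (fun y => fderiv ℝ f y u)) x a c := by
      rw [fderiv_clm_apply hD (differentiableAt_const c)]
      simp
    rw [← this]
    congr 1
    apply EventuallyEq.fderiv_eq
    filter_upwards [hev] with y hy
    rw [hy]; rfl
  rw [e1, e1] at key
  rw [← key]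
  congr 1
  apply EventuallyEq.fderiv_eq
  filter_upwards [eventually_contDiffAt_two hf] with y hy
  exact fderiv_fderiv_symm hy b u

variable {A : E →L[ℝ] E'} {B : E' →L[ℝ] E} {P : E → (E →L[ℝ] ℝ) →L[ℝ] E} {H : E' → ℝ} {y₀ : E'}

/-- If the hamiltonian vector fields of the constraints annihilate `H`, then the second derivative
of this identity at a critical point expresses the third derivative of `H`. -/
theorem third_derivative_of_invariant (hAB : ∀ y, A (B y) = y)
    (hP : ContDiffAt ℝ ∞ P (B y₀)) (hH : ContDiffAt ℝ ∞ H y₀) (hH0 : fderiv ℝ H y₀ = 0)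
    (κ : E →L[ℝ] ℝ) (hinv : ∀ᶠ y in 𝓝 y₀, fderiv ℝ H y (A (P (B y) κ)) = 0)
    (u b : E') (hb : P (B y₀) κ = B b) :
    fderiv ℝ (fun y => fderiv ℝ (fderiv ℝ H) y u u) y₀ b
      = - 2 * fderiv ℝ (fderiv ℝ H) y₀ u (A (fderiv ℝ P (B y₀) (B u) κ)) := by
  rw [fderiv_third_symm hH]
  set Y : E' → E' := fun y => A (P (B y) κ) with hY
  have hPB : ContDiffAt ℝ ∞ (fun y => P (B y)) y₀ := hP.comp y₀ B.contDiff.contDiffAt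
  have hYs : ContDiffAt ℝ ∞ Y y₀ :=
    A.contDiff.contDiffAt.comp y₀ (hPB.clm_apply contDiffAt_const)
  have hY' : fderiv ℝ Y y₀ u = A (fderiv ℝ P (B y₀) (B u) κ) := by
    have h1 : HasFDerivAt (fun y => P (B y)) ((fderiv ℝ P (B y₀)).comp B) y₀ :=
      (hP.differentiableAt (by simp)).hasFDerivAt.comp y₀ B.hasFDerivAt
    have h2 := A.hasFDerivAt.comp y₀ (h1.clm_apply (hasFDerivAt_const κ y₀))
    have h3 : fderiv ℝ Y y₀ = _ := h2.fderiv
    rw [h3]; simp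
  have hY0 : Y y₀ = b := by simp [hY, hb, hAB]
  have h1 := contDiffAt_fderiv hH
  have h2 := contDiffAt_fderiv h1
  -- first derivative of the identity
  have hfirst : ∀ᶠ y in 𝓝 y₀, fderiv ℝ (fderiv ℝ H) y u (Y y) + fderiv ℝ H y (fderiv ℝ Y y u)
      = 0 := by
    filter_upwards [hinv.eventually_nhds, eventually_contDiffAt_two h1, eventually_contDiffAt_two hYs]
      with y hy hy1 hy2
    have h3 : fderiv ℝ (fun y => fderiv ℝ H y (Y y)) y = 0 := by
      have : (fun y => fderiv ℝ H y (Y y)) =ᶠ[𝓝 y] fun _ => 0 := hy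
      rw [this.fderiv_eq]; simp
    rw [fderiv_clm_apply (hy1.differentiableAt (by simp)) (hy2.differentiableAt (by simp))] at h3
    have := DFunLike.congr_fun h3 u
    simp at this
    linarith
  have hd2 : DifferentiableAt ℝ (fun y => fderiv ℝ (fderiv ℝ H) y u) y₀ :=
    (h2.clm_apply contDiffAt_const).differentiableAt (by simp)
  have hdY : DifferentiableAt ℝ Y y₀ := hYs.differentiableAt (by simp)
  have hd1 : DifferentiableAt ℝ (fderiv ℝ H) y₀ := h1.differentiableAt (by simp)
  have hdY' : DifferentiableAt ℝ (fun y => fderiv ℝ Y y u) y₀ :=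
    ((contDiffAt_fderiv hYs).clm_apply contDiffAt_const).differentiableAt (by simp)
  have h4 : fderiv ℝ (fun y => fderiv ℝ (fderiv ℝ H) y u (Y y)
      + fderiv ℝ H y (fderiv ℝ Y y u)) y₀ = 0 := by
    have : (fun y => fderiv ℝ (fderiv ℝ H) y u (Y y) + fderiv ℝ H y (fderiv ℝ Y y u))
      =ᶠ[𝓝 y₀] fun _ => 0 := hfirst
    rw [this.fderiv_eq]; simp
  rw [fderiv_fun_add (hd2.clm_apply hdY) (hd1.clm_apply hdY'), fderiv_clm_apply hd2 hdY,
    fderiv_clm_apply hd1 hdY'] at h4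
  have h5 := DFunLike.congr_fun h4 u
  -- The cross term occurs once in each of the two product rules, whence the factor 2; the term with
  -- the second derivative of `Y` dies with the differential of `H`.
  simp only [_root_.add_apply, ContinuousLinearMap.comp_apply, hH0, hY', hY0,
    ContinuousLinearMap.flip_apply, _root_.zero_apply, zero_add] at h5
  have h6 : fderiv ℝ (fun y => fderiv ℝ (fderiv ℝ H) y u b) y₀ u
      = fderiv ℝ (fun y => fderiv ℝ (fderiv ℝ H) y u) y₀ u b := by
    rw [fderiv_clm_apply hd2 (differentiableAt_const b)]; simp
  rw [h6]; linarith

/-- The Sternberg-Weinstein bracket of a quadratic approximation with a constraint, in coordinates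
in which the coisotropic submanifold is the range of `B`. -/
theorem linearized_bracket_eq_zero (hAB : ∀ y, A (B y) = y)
    (hP : ContDiffAt ℝ ∞ P (B y₀)) (hH : ContDiffAt ℝ ∞ H y₀) (hH0 : fderiv ℝ H y₀ = 0)
    (hskew : ∀ᶠ z in 𝓝 (B y₀), ∀ α β : E →L[ℝ] ℝ, α (P z β) = - β (P z α))
    (hco : ∀ᶠ y in 𝓝 y₀, ∀ α β : E →L[ℝ] ℝ, (∀ v, α (B v) = 0) → (∀ v, β (B v) = 0) →
      α (P (B y) β) = 0)
    (hinv : ∀ᶠ y in 𝓝 y₀, ∀ α : E →L[ℝ] ℝ, (∀ v, α (B v) = 0) →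
      fderiv ℝ H y (A (P (B y) α)) = 0)
    {f g h k : E → ℝ} (hh : ContDiffAt ℝ ∞ h (B y₀)) (hk : ContDiffAt ℝ ∞ k (B y₀))
    (u : E') {T : Set E'}
    (hF1 : ∀ v, fderiv ℝ h (B y₀) (B v) = 2 * fderiv ℝ (fderiv ℝ H) y₀ u v)
    (hF2 : ∀ b ∈ T, fderiv ℝ f (B y₀) (B b) + fderiv ℝ (fderiv ℝ h) (B y₀) (B b) (B u)
      = fderiv ℝ (fun y => fderiv ℝ (fderiv ℝ H) y u u) y₀ b)
    (hG1 : ∀ v, fderiv ℝ k (B y₀) (B v) = 0)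
    (hG2 : ∀ b ∈ T, fderiv ℝ g (B y₀) (B b) + fderiv ℝ (fderiv ℝ k) (B y₀) (B b) (B u) = 0)
    {b₁ b₂ : E'} (hb₁ : b₁ ∈ T) (hb₂ : b₂ ∈ T)
    (hk₁ : P (B y₀) (fderiv ℝ k (B y₀)) = B b₁) (hh₂ : P (B y₀) (fderiv ℝ h (B y₀)) = B b₂) :
    fderiv ℝ f (B y₀) (P (B y₀) (fderiv ℝ k (B y₀)))
      + fderiv ℝ h (B y₀) (P (B y₀) (fderiv ℝ g (B y₀)))
      + fderiv ℝ (fun z => fderiv ℝ h z (P z (fderiv ℝ k z))) (B y₀) (B u) = 0 := by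
  have dh := (contDiffAt_fderiv hh).differentiableAt (n := ∞) (by simp)
  have dk := (contDiffAt_fderiv hk).differentiableAt (n := ∞) (by simp)
  have dP := hP.differentiableAt (by simp)
  have sk : ∀ α β : E →L[ℝ] ℝ, α (P (B y₀) β) = - β (P (B y₀) α) := hskew.self_of_nhds
  -- derivatives of the structural identities
  have skew' : ∀ (α β : E →L[ℝ] ℝ) w, α (fderiv ℝ P (B y₀) w β)
      = - β (fderiv ℝ P (B y₀) w α) := by
    intro α β w
    have e1 : ∀ (α β : E →L[ℝ] ℝ), HasFDerivAt (fun z => α (P z β))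
        (α.comp ((fderiv ℝ P (B y₀)).flip β)) (B y₀) := by
      intro α β
      have := α.hasFDerivAt.comp (B y₀) (dP.hasFDerivAt.clm_apply (hasFDerivAt_const β (B y₀)))
      refine this.congr_fderiv ?_
      ext w; simp
    have e2 : (fun z => α (P z β)) =ᶠ[𝓝 (B y₀)] fun z => - β (P z α) := by
      filter_upwards [hskew] with z hz using hz α β
    have e3 := e2.fderiv_eq (𝕜 := ℝ)
    rw [(e1 α β).fderiv, (e1 β α).fun_neg.fderiv] at e3
    simpa using DFunLike.congr_fun e3 w
  -- Coisotropy holds only along the range of `B`, so it may be differentiated only in those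
  -- directions. The conormal space is constant in these coordinates, so constant covectors are
  -- enough.
  have co' : ∀ (α β : E →L[ℝ] ℝ), (∀ v, α (B v) = 0) → (∀ v, β (B v) = 0) →
      ∀ w, α (fderiv ℝ P (B y₀) (B w) β) = 0 := by
    intro α β hα hβ w
    have e1 : HasFDerivAt (fun y => α (P (B y) β))
        ((α.comp ((fderiv ℝ P (B y₀)).flip β)).comp B) y₀ := by
      have h1 : HasFDerivAt (fun y => P (B y)) ((fderiv ℝ P (B y₀)).comp B) y₀ :=
        dP.hasFDerivAt.comp y₀ B.hasFDerivAt
      have := α.hasFDerivAt.comp y₀ (h1.clm_apply (hasFDerivAt_const β y₀))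
      refine this.congr_fderiv ?_
      ext w; simp
    have e2 : (fun y => α (P (B y) β)) =ᶠ[𝓝 y₀] fun _ => 0 := by
      filter_upwards [hco] with z hz using hz α β hα hβ
    have e3 := e2.fderiv_eq (𝕜 := ℝ)
    rw [e1.fderiv] at e3
    simpa using DFunLike.congr_fun e3 w
  have hthird := third_derivative_of_invariant hAB hP hH hH0 (fderiv ℝ k (B y₀))
    (hinv.mono fun y hy => hy _ hG1) u b₁ hk₁
  have hbr : fderiv ℝ (fun z => fderiv ℝ h z (P z (fderiv ℝ k z))) (B y₀) (B u)
      = fderiv ℝ (fderiv ℝ h) (B y₀) (B u) (P (B y₀) (fderiv ℝ k (B y₀)))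
        + fderiv ℝ h (B y₀) (fderiv ℝ P (B y₀) (B u) (fderiv ℝ k (B y₀)))
        + fderiv ℝ h (B y₀) (P (B y₀) (fderiv ℝ (fderiv ℝ k) (B y₀) (B u))) := by
    rw [fderiv_clm_apply dh (dP.clm_apply dk), fderiv_clm_apply dP dk]
    simp; ring
  -- the component of the differential of `h` along the submanifold
  set β : E →L[ℝ] ℝ := fderiv ℝ h (B y₀) - (2 : ℝ) • (fderiv ℝ (fderiv ℝ H) y₀ u).comp A with hβ
  have hβB : ∀ v, β (B v) = 0 := by
    intro v; simp [hβ, hF1, hAB]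
  -- The conormal part `β` of the differential of `h` pairs to zero by `co'`; the remaining part
  -- factors through `A` and is moved across by skewness.
  have hκ : fderiv ℝ k (B y₀) (fderiv ℝ P (B y₀) (B u) (fderiv ℝ h (B y₀)))
      = - 2 * fderiv ℝ (fderiv ℝ H) y₀ u (A (fderiv ℝ P (B y₀) (B u) (fderiv ℝ k (B y₀)))) := by
    have e0 : fderiv ℝ h (B y₀) = β + (2 : ℝ) • (fderiv ℝ (fderiv ℝ H) y₀ u).comp A := by
      simp [hβ]
    have e1 := co' _ _ hG1 hβB u
    have e2 := skew' (fderiv ℝ k (B y₀)) ((fderiv ℝ (fderiv ℝ H) y₀ u).comp A) (B u)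
    rw [e0, map_add, map_add, e1, map_smul, map_smul, e2]
    simp
  -- After moving `P` by skewness, `hF2` at `b₁` produces the third derivative of `H`, which cancels
  -- against the derivative of `P`; the rest is `hG2` at `b₂`.
  rw [hbr, hk₁, sk _ (fderiv ℝ g (B y₀)), sk _ (fderiv ℝ (fderiv ℝ k) (B y₀) (B u)), hh₂,
    skew' _ (fderiv ℝ k (B y₀)), hκ, ← hthird, fderiv_fderiv_symm (hh.of_le two_le_infty) (B u),
    fderiv_fderiv_symm (hk.of_le two_le_infty) (B u), ← hF2 b₁ hb₁]
  have := hG2 b₂ hb₂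
  linarith

end Calculus

/-! ### Charts, and invariance of the Hessian at critical points. -/

section Charts

variable {E : Type*} [NormedAddCommGroup E] [NormedSpace ℝ E]
  {M : Type*} [TopologicalSpace M] [ChartedSpace E M]

/-- The derivative at `z` of a chart. -/
def dChart (e : OpenPartialHomeomorph M E) (z : M) : TangentSpace 𝓘(ℝ, E) z →L[ℝ] E :=
  mfderiv 𝓘(ℝ, E) 𝓘(ℝ, E) e z

/-- The inverse of the derivative at `z` of a chart. -/
def dChartInv (e : OpenPartialHomeomorph M E) (z : M) : E →L[ℝ] TangentSpace 𝓘(ℝ, E) z :=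
  (mfderiv 𝓘(ℝ, E) 𝓘(ℝ, E) e.symm (e z) : E →L[ℝ] E)

variable {e : OpenPartialHomeomorph M E} {z : M}

theorem mdifferentiableAt_chart (he : e ∈ IsManifold.maximalAtlas 𝓘(ℝ, E) ∞ M)
    (hz : z ∈ e.source) : MDifferentiableAt 𝓘(ℝ, E) 𝓘(ℝ, E) e z :=
  (contMDiffAt_of_mem_maximalAtlas he hz).mdifferentiableAt (by simp)

theorem mdifferentiableAt_chart_symm (he : e ∈ IsManifold.maximalAtlas 𝓘(ℝ, E) ∞ M)
    {y : E} (hy : y ∈ e.target) : MDifferentiableAt 𝓘(ℝ, E) 𝓘(ℝ, E) e.symm y :=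
  (contMDiffAt_symm_of_mem_maximalAtlas he hy).mdifferentiableAt (by simp)

theorem mdifferentiable_chart (he : e ∈ IsManifold.maximalAtlas 𝓘(ℝ, E) ∞ M) :
    e.MDifferentiable 𝓘(ℝ, E) 𝓘(ℝ, E) :=
  ⟨fun _ hz => (mdifferentiableAt_chart he hz).mdifferentiableWithinAt,
    fun _ hy => (mdifferentiableAt_chart_symm he hy).mdifferentiableWithinAt⟩

theorem dChartInv_dChart (he : e ∈ IsManifold.maximalAtlas 𝓘(ℝ, E) ∞ M)
    (hz : z ∈ e.source) (u : TangentSpace 𝓘(ℝ, E) z) : dChartInv e z (dChart e z u) = u := by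
  have h := (mdifferentiable_chart he).symm_comp_deriv hz
  exact DFunLike.congr_fun h u

theorem dChart_dChartInv (he : e ∈ IsManifold.maximalAtlas 𝓘(ℝ, E) ∞ M)
    (hz : z ∈ e.source) (v : E) : dChart e z (dChartInv e z v) = v := by
  have h := (mdifferentiable_chart he).comp_symm_deriv (e.map_source hz)
  rw [e.left_inv hz] at h
  exact DFunLike.congr_fun h v

theorem contDiffAt_comp_chart_symm (he : e ∈ IsManifold.maximalAtlas 𝓘(ℝ, E) ∞ M)
    (hz : z ∈ e.source) {f : M → ℝ} (hf : ContMDiffAt 𝓘(ℝ, E) 𝓘(ℝ, ℝ) ∞ f z) :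
    ContDiffAt ℝ ∞ (f ∘ e.symm) (e z) := by
  rw [← contMDiffAt_iff_contDiffAt]
  refine ContMDiffAt.comp (e z) (I' := 𝓘(ℝ, E)) ?_
    (contMDiffAt_symm_of_mem_maximalAtlas he (e.map_source hz))
  rwa [e.left_inv hz]

theorem mfderiv_eq_fderiv_chart (he : e ∈ IsManifold.maximalAtlas 𝓘(ℝ, E) ∞ M)
    (hz : z ∈ e.source) {f : M → ℝ} (hf : MDifferentiableAt 𝓘(ℝ, E) 𝓘(ℝ, ℝ) f z)
    (u : TangentSpace 𝓘(ℝ, E) z) :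
    mfderiv 𝓘(ℝ, E) 𝓘(ℝ, ℝ) f z u = fderiv ℝ (f ∘ e.symm) (e z) (dChart e z u) := by
  have h1 : f =ᶠ[𝓝 z] (f ∘ e.symm) ∘ e := by
    filter_upwards [e.open_source.mem_nhds hz] with x hx
    simp [e.left_inv hx]
  have h2 : MDifferentiableAt 𝓘(ℝ, E) 𝓘(ℝ, ℝ) (f ∘ e.symm) (e z) := by
    refine MDifferentiableAt.comp (e z) (I' := 𝓘(ℝ, E)) ?_
      (mdifferentiableAt_chart_symm he (e.map_source hz))
    rwa [e.left_inv hz]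
  rw [h1.mfderiv_eq, mfderiv_comp z h2 (mdifferentiableAt_chart he hz), mfderiv_eq_fderiv]
  rfl

theorem dAt_eq (he : e ∈ IsManifold.maximalAtlas 𝓘(ℝ, E) ∞ M) (hz : z ∈ e.source)
    (f : SmoothFn E M) (u : TangentSpace 𝓘(ℝ, E) z) :
    dAt f z u = fderiv ℝ (f ∘ e.symm) (e z) (dChart e z u) :=
  mfderiv_eq_fderiv_chart he hz (f.contMDiff.mdifferentiableAt (by simp)) u

theorem dAt_dChartInv (he : e ∈ IsManifold.maximalAtlas 𝓘(ℝ, E) ∞ M) (hz : z ∈ e.source)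
    (f : SmoothFn E M) (v : E) :
    dAt f z (dChartInv e z v) = fderiv ℝ (f ∘ e.symm) (e z) v := by
  rw [dAt_eq he hz, dChart_dChartInv he hz]

variable {E' : Type*} [NormedAddCommGroup E'] [NormedSpace ℝ E']

/-- Writing the map through the preferred chart reduces this to the chain rule at a critical point.
With `τ` an inverse chart it gives chart independence of the Hessian. -/
theorem hessAt_comp [IsManifold 𝓘(ℝ, E) ∞ M] {τ : E' → M} {y : E'}
    (hτ : ContMDiffAt 𝓘(ℝ, E') 𝓘(ℝ, E) ∞ τ y) (H : SmoothFn E M) (h0 : dAt H (τ y) = 0)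
    (u v : E') :
    fderiv ℝ (fderiv ℝ (H ∘ τ)) y u v
      = hessAt H (τ y) (mfderiv 𝓘(ℝ, E') 𝓘(ℝ, E) τ y u) (mfderiv 𝓘(ℝ, E') 𝓘(ℝ, E) τ y v) := by
  set e := chartAt E (τ y) with he_def
  have he : e ∈ IsManifold.maximalAtlas 𝓘(ℝ, E) ∞ M := IsManifold.chart_mem_maximalAtlas _
  have hz : τ y ∈ e.source := mem_chart_source E _
  set τ' : E' → E := e ∘ τ
  have hτ' : ContDiffAt ℝ ∞ τ' y := by
    rw [← contMDiffAt_iff_contDiffAt]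
    exact (contMDiffAt_of_mem_maximalAtlas he hz).comp y hτ
  have h1 : H ∘ τ =ᶠ[𝓝 y] (H ∘ e.symm) ∘ τ' := by
    filter_upwards [hτ.continuousAt.preimage_mem_nhds (e.open_source.mem_nhds hz)] with x hx
    simp [τ', e.left_inv hx]
  have hc : fderiv ℝ (H ∘ e.symm) (τ' y) = 0 := by
    ext w
    have := dAt_dChartInv he hz H w
    rw [h0] at this
    exact this.symm
  rw [h1.fderiv.fderiv_eq, fderiv_fderiv_comp_of_critical (τ := τ')
    (contDiffAt_comp_chart_symm he hz H.contMDiff.contMDiffAt) hτ' hc]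
  have h2 : mfderiv 𝓘(ℝ, E') 𝓘(ℝ, E) τ y = fderiv ℝ τ' y := by
    have h3 := mfderiv_comp y (mdifferentiableAt_chart he hz) (hτ.mdifferentiableAt (by simp))
    -- The tangent space is identified with the model space through this very chart, so its
    -- derivative at the base point is the identity.
    have h4 : mfderiv 𝓘(ℝ, E) 𝓘(ℝ, E) e (τ y) = ContinuousLinearMap.id ℝ _ := by
      have := mfderiv_extChartAt_self (I := 𝓘(ℝ, E)) (x := τ y)
      simp only [mfld_simps] at this
      exact this
    rw [h4] at h3
    rw [← mfderiv_eq_fderiv]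
    exact h3.symm
  rw [h2]
  rfl

theorem hessAt_eq_chart [IsManifold 𝓘(ℝ, E) ∞ M]
    (he : e ∈ IsManifold.maximalAtlas 𝓘(ℝ, E) ∞ M) (hz : z ∈ e.source)
    (H : SmoothFn E M) (h0 : dAt H z = 0) (u v : TangentSpace 𝓘(ℝ, E) z) :
    hessAt H z u v
      = fderiv ℝ (fderiv ℝ (H ∘ e.symm)) (e z) (dChart e z u) (dChart e z v) := by
  have h := hessAt_comp (y := e z) (contMDiffAt_symm_of_mem_maximalAtlas he (e.map_source hz)) H
    (by rwa [e.left_inv hz]) (dChart e z u) (dChart e z v)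
  rw [h]
  have hu : ∀ w, mfderiv 𝓘(ℝ, E) 𝓘(ℝ, E) e.symm (e z) (dChart e z w) = w :=
    fun w => dChartInv_dChart he hz w
  rw [hu, hu, e.left_inv hz]

theorem hessAt_symm [IsManifold 𝓘(ℝ, E) ∞ M] (H : SmoothFn E M)
    (u v : TangentSpace 𝓘(ℝ, E) z) : hessAt H z u v = hessAt H z v u := by
  have h := contDiffAt_comp_chart_symm (IsManifold.chart_mem_maximalAtlas z)
    (mem_chart_source E z) (H.contMDiff.contMDiffAt (x := z))
  exact fderiv_fderiv_symm (h.of_le two_le_infty) u v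

variable {N : Type*} [TopologicalSpace N] [ChartedSpace E' N]

/-- Again the second derivative of the map drops out because `H` is critical. Agreement is required
only near `n`, so that local extensions of a function on a submanifold can be used. -/
theorem hessAt_map [IsManifold 𝓘(ℝ, E) ∞ M] [IsManifold 𝓘(ℝ, E') ∞ N]
    (ι : SmoothMap E' N E M) (H : SmoothFn E M) (H' : SmoothFn E' N)
    {n : N} (hH : ∀ᶠ n' in 𝓝 n, H' n' = H (ι n')) (h0 : dAt H (ι n) = 0)
    (u v : TangentSpace 𝓘(ℝ, E') n) :
    hessAt H' n u v = hessAt H (ι n) (tangentAt ι n u) (tangentAt ι n v) := by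
  set e := chartAt E' n
  have he : e ∈ IsManifold.maximalAtlas 𝓘(ℝ, E') ∞ N := IsManifold.chart_mem_maximalAtlas _
  have hn : n ∈ e.source := mem_chart_source E' _
  have hι := ι.contMDiff.mdifferentiableAt (x := n) (by simp)
  have h0' : dAt H' n = 0 := by
    have : (H' : N → ℝ) =ᶠ[𝓝 n] H ∘ ι := hH
    unfold dAt at h0 ⊢
    rw [this.mfderiv_eq, mfderiv_comp n (H.contMDiff.mdifferentiableAt (by simp)) hι, h0]
    exact ContinuousLinearMap.zero_comp _
  rw [hessAt_eq_chart he hn H' h0']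
  have : H' ∘ e.symm =ᶠ[𝓝 (e n)] H ∘ (ι ∘ e.symm) := by
    have h1 := e.continuousAt_symm (e.map_source hn)
    rw [ContinuousAt, e.left_inv hn] at h1
    exact h1.eventually hH
  have hs := contMDiffAt_symm_of_mem_maximalAtlas he (e.map_source hn)
  rw [this.fderiv.fderiv_eq, hessAt_comp (y := e n) (ι.contMDiff.contMDiffAt.comp _ hs) H
    (by rw [Function.comp_apply, e.left_inv hn]; exact h0)]
  have hd : ∀ w, mfderiv 𝓘(ℝ, E') 𝓘(ℝ, E) (ι ∘ e.symm) (e n) (dChart e n w) = tangentAt ι n w := by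
    intro w
    have hι' := ι.contMDiff.mdifferentiableAt (x := e.symm (e n)) (by simp)
    rw [mfderiv_comp (e n) hι' (hs.mdifferentiableAt (by simp))]
    have := dChartInv_dChart he hn w
    change mfderiv 𝓘(ℝ, E') 𝓘(ℝ, E) ι (e.symm (e n)) (dChartInv e n (dChart e n w)) = _
    rw [this, e.left_inv hn]; rfl
  rw [hd, hd, Function.comp_apply, e.left_inv hn]

variable {EX : Type*} [NormedAddCommGroup EX] [NormedSpace ℝ EX]
  {X : Type*} [TopologicalSpace X] [ChartedSpace EX X]

/-- In a chart the differential of `H` is zero along the image of `φ`; differentiating this identity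
along the submanifold gives the claim. -/
theorem hessAt_tangent_left [IsManifold 𝓘(ℝ, E) ∞ M]
    (φ : SmoothMap EX X E M) (H : SmoothFn E M) {x : X} (h0 : ∀ᶠ y in 𝓝 x, dAt H (φ y) = 0)
    {u : TangentSpace 𝓘(ℝ, E) (φ x)} (hu : u ∈ tangentRange φ x)
    (v : TangentSpace 𝓘(ℝ, E) (φ x)) : hessAt H (φ x) u v = 0 := by
  obtain ⟨ξ, rfl⟩ := hu
  set e := chartAt E (φ x)
  have he : e ∈ IsManifold.maximalAtlas 𝓘(ℝ, E) ∞ M := IsManifold.chart_mem_maximalAtlas _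
  have hz : φ x ∈ e.source := mem_chart_source E _
  rw [hessAt_eq_chart he hz H h0.self_of_nhds]
  have hev : (fun y => fderiv ℝ (H ∘ e.symm) (e (φ y))) =ᶠ[𝓝 x] fun _ => 0 := by
    filter_upwards [h0, φ.contMDiff.continuous.continuousAt.preimage_mem_nhds
      (e.open_source.mem_nhds hz)] with y hy hy2
    ext w
    have := dAt_dChartInv he hy2 H w
    rw [hy] at this
    exact this.symm
  have hd := hev.mfderiv_eq (I := 𝓘(ℝ, EX)) (I' := 𝓘(ℝ, E →L[ℝ] ℝ))
  rw [mfderiv_const] at hd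
  have h2 : DifferentiableAt ℝ (fderiv ℝ (H ∘ e.symm)) (e (φ x)) :=
    (contDiffAt_fderiv (contDiffAt_comp_chart_symm he hz H.contMDiff.contMDiffAt)).differentiableAt
      (by simp)
  have hφ := φ.contMDiff.mdifferentiableAt (x := x) (by simp)
  have h3 := mfderiv_comp x (g := fderiv ℝ (H ∘ e.symm)) (f := e ∘ φ)
    h2.mdifferentiableAt ((mdifferentiableAt_chart he hz).comp x hφ)
  rw [mfderiv_comp x (mdifferentiableAt_chart he hz) hφ, mfderiv_eq_fderiv] at h3
  have h4 : mfderiv 𝓘(ℝ, EX) 𝓘(ℝ, E →L[ℝ] ℝ) (fderiv ℝ (H ∘ e.symm) ∘ e ∘ φ) x = 0 := hd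
  rw [h4] at h3
  have h5 : (0 : E →L[ℝ] ℝ)
      = fderiv ℝ (fderiv ℝ (H ∘ e.symm)) (e (φ x)) (dChart e (φ x) (tangentAt φ x ξ)) :=
    DFunLike.congr_fun h3 ξ
  exact (DFunLike.congr_fun h5 (dChart e (φ x) v)).symm

end Charts

/-! ### Local frames of TM|_X and partial derivatives with respect to them. -/

section RestrictedTangentCharts

variable {E : Type*} [NormedAddCommGroup E] [NormedSpace ℝ E]
  {M : Type*} [TopologicalSpace M] [ChartedSpace E M]
  {e c : OpenPartialHomeomorph M E} {z : M}

theorem contDiffAt_transition (he : e ∈ IsManifold.maximalAtlas 𝓘(ℝ, E) ∞ M)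
    (hc : c ∈ IsManifold.maximalAtlas 𝓘(ℝ, E) ∞ M) (hz : z ∈ e.source) (hzc : z ∈ c.source) :
    ContDiffAt ℝ ∞ (e ∘ c.symm) (c z) := by
  rw [← contMDiffAt_iff_contDiffAt]
  refine ContMDiffAt.comp (c z) (I' := 𝓘(ℝ, E)) ?_
    (contMDiffAt_symm_of_mem_maximalAtlas hc (c.map_source hzc))
  rw [c.left_inv hzc]
  exact contMDiffAt_of_mem_maximalAtlas he hz

theorem dChart_dChartInv_eq_fderiv (he : e ∈ IsManifold.maximalAtlas 𝓘(ℝ, E) ∞ M)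
    (hc : c ∈ IsManifold.maximalAtlas 𝓘(ℝ, E) ∞ M) (hz : z ∈ e.source) (hzc : z ∈ c.source)
    (v : E) : dChart e z (dChartInv c z v) = fderiv ℝ (e ∘ c.symm) (c z) v := by
  have h1 : MDifferentiableAt 𝓘(ℝ, E) 𝓘(ℝ, E) e (c.symm (c z)) := by
    rw [c.left_inv hzc]; exact mdifferentiableAt_chart he hz
  rw [← mfderiv_eq_fderiv, mfderiv_comp (c z) h1
    (mdifferentiableAt_chart_symm hc (c.map_source hzc)), c.left_inv hzc]
  rfl

variable {EX : Type*} [NormedAddCommGroup EX] [NormedSpace ℝ EX]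
  {X : Type*} [TopologicalSpace X] [ChartedSpace EX X]

/-- The differential at `x` of a real function, as a linear form on the model space. -/
def dFun (f : X → ℝ) (x : X) : EX →L[ℝ] ℝ :=
  mfderiv 𝓘(ℝ, EX) 𝓘(ℝ, ℝ) f x

variable [IsManifold 𝓘(ℝ, E) ∞ M]
  {φ : SmoothMap EX X E M}

/-- The fibre coordinate on `TM|_X` defined by a chart of `M`. -/
def fibreCoord (φ : SmoothMap EX X E M) (e : OpenPartialHomeomorph M E)
    (p : RestrictedTangent φ) : E :=
  dChart e (φ p.1) p.2

/-- The local frame of `TM|_X` defined by a chart of `M`. -/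
def frameMap (φ : SmoothMap EX X E M) (e : OpenPartialHomeomorph M E) (p : X × E) :
    RestrictedTangent φ :=
  ⟨p.1, dChartInv e (φ p.1) p.2⟩

theorem trivializationAt_tangent_snd {z₀ : M} (hz : z ∈ (chartAt E z₀).source)
    (v : TangentSpace 𝓘(ℝ, E) z) :
    (trivializationAt E (TangentSpace 𝓘(ℝ, E)) z₀ ⟨z, v⟩).2 = dChart (chartAt E z₀) z v := by
  have h1 := TangentBundle.continuousLinearMapAt_trivializationAt (I := 𝓘(ℝ, E)) hz
  have h2 := DFunLike.congr_fun h1 v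
  have h3 : (trivializationAt E (TangentSpace 𝓘(ℝ, E)) z₀).continuousLinearMapAt ℝ z v
      = (trivializationAt E (TangentSpace 𝓘(ℝ, E)) z₀ ⟨z, v⟩).2 := by
    rw [Trivialization.continuousLinearMapAt_apply, Trivialization.linearMapAt_apply, if_pos]
    simpa using hz
  rw [h3] at h2
  simp only [mfld_simps] at h2
  exact h2

theorem trivializationAt_snd_eq {x₀ : X} {p : RestrictedTangent φ}
    (hp : φ p.1 ∈ (chartAt E (φ x₀)).source) :
    (trivializationAt E (φ *ᵖ (TangentSpace 𝓘(ℝ, E) : M → Type _)) x₀ p).2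
      = dChart (chartAt E (φ x₀)) (φ p.1) p.2 :=
  trivializationAt_tangent_snd hp p.2

/-- The bundle structure comes from preferred charts; on fibres an arbitrary chart differs from
these by the derivative of a transition map, which is smooth in the base point. -/
theorem contMDiffAt_fibreCoord (he : e ∈ IsManifold.maximalAtlas 𝓘(ℝ, E) ∞ M)
    {p : RestrictedTangent φ} (hp : φ p.1 ∈ e.source) :
    ContMDiffAt (𝓘(ℝ, EX).prod 𝓘(ℝ, E)) 𝓘(ℝ, E) ∞ (fibreCoord φ e) p := by
  set c := chartAt E (φ p.1)
  have hc : c ∈ IsManifold.maximalAtlas 𝓘(ℝ, E) ∞ M := IsManifold.chart_mem_maximalAtlas _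
  have hz : φ p.1 ∈ c.source := mem_chart_source E _
  have hπ : ContMDiffAt (𝓘(ℝ, EX).prod 𝓘(ℝ, E)) 𝓘(ℝ, E) ∞
      (fun q : RestrictedTangent φ => φ q.1) p :=
    φ.contMDiff.contMDiffAt.comp p (contMDiffAt_proj (φ *ᵖ (TangentSpace 𝓘(ℝ, E) : M → Type _)))
  have h1 := (contMDiffAt_totalSpace.1 (contMDiffAt_id (I := 𝓘(ℝ, EX).prod 𝓘(ℝ, E)) (n := ∞)
    (x := p))).2
  have h2 : ContMDiffAt (𝓘(ℝ, EX).prod 𝓘(ℝ, E)) 𝓘(ℝ, E →L[ℝ] E) ∞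
      (fun q : RestrictedTangent φ => fderiv ℝ (e ∘ c.symm) (c (φ q.1))) p :=
    ContMDiffAt.comp p (contDiffAt_fderiv (contDiffAt_transition he hc hp hz)).contMDiffAt
      ((contMDiffAt_of_mem_maximalAtlas hc hz).comp p hπ)
  refine (h2.clm_apply h1).congr_of_eventuallyEq ?_
  filter_upwards [hπ.continuousAt.preimage_mem_nhds (e.open_source.mem_nhds hp),
    hπ.continuousAt.preimage_mem_nhds (c.open_source.mem_nhds hz)] with q hq hqc
  have h3 : (trivializationAt E (φ *ᵖ (TangentSpace 𝓘(ℝ, E) : M → Type _)) p.1 q).2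
      = dChart c (φ q.1) q.2 := trivializationAt_snd_eq hqc
  simp only [id]
  rw [h3, ← dChart_dChartInv_eq_fderiv he hc hq hqc]
  exact congrArg (dChart e (φ q.1)) (dChartInv_dChart hc hqc _).symm

theorem contMDiffAt_frameMap (he : e ∈ IsManifold.maximalAtlas 𝓘(ℝ, E) ∞ M)
    {p : X × E} (hp : φ p.1 ∈ e.source) :
    ContMDiffAt (𝓘(ℝ, EX).prod 𝓘(ℝ, E)) (𝓘(ℝ, EX).prod 𝓘(ℝ, E)) ∞ (frameMap φ e) p := by
  rw [contMDiffAt_totalSpace]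
  refine ⟨contMDiffAt_fst, ?_⟩
  set c := chartAt E (φ p.1)
  have hc : c ∈ IsManifold.maximalAtlas 𝓘(ℝ, E) ∞ M := IsManifold.chart_mem_maximalAtlas _
  have hz : φ p.1 ∈ c.source := mem_chart_source E _
  have hπ : ContMDiffAt (𝓘(ℝ, EX).prod 𝓘(ℝ, E)) 𝓘(ℝ, E) ∞
      (fun q : X × E => φ q.1) p :=
    φ.contMDiff.contMDiffAt.comp p contMDiffAt_fst
  have h2 : ContMDiffAt (𝓘(ℝ, EX).prod 𝓘(ℝ, E)) 𝓘(ℝ, E →L[ℝ] E) ∞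
      (fun q : X × E => fderiv ℝ (c ∘ e.symm) (e (φ q.1))) p :=
    ContMDiffAt.comp p (contDiffAt_fderiv (contDiffAt_transition hc he hz hp)).contMDiffAt
      ((contMDiffAt_of_mem_maximalAtlas he hp).comp p hπ)
  refine (h2.clm_apply contMDiffAt_snd).congr_of_eventuallyEq ?_
  filter_upwards [hπ.continuousAt.preimage_mem_nhds (e.open_source.mem_nhds hp),
    hπ.continuousAt.preimage_mem_nhds (c.open_source.mem_nhds hz)] with q hq hqc
  rw [← dChart_dChartInv_eq_fderiv hc he hqc hq]
  exact trivializationAt_snd_eq (p := frameMap φ e q) hqc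

omit [IsManifold 𝓘(ℝ, E) ∞ M] in
theorem frameMap_fibreCoord (he : e ∈ IsManifold.maximalAtlas 𝓘(ℝ, E) ∞ M)
    {p : RestrictedTangent φ} (hp : φ p.1 ∈ e.source) :
    frameMap φ e (p.1, fibreCoord φ e p) = p := by
  rcases p with ⟨x, v⟩
  exact congrArg (TotalSpace.mk x) (dChartInv_dChart he hp v)

/-- Two functions on `TM|_X` have the same differential if their partial derivatives with respect
to a local frame agree. -/
theorem mfderiv_eq_iff_frameMap (he : e ∈ IsManifold.maximalAtlas 𝓘(ℝ, E) ∞ M)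
    {p : RestrictedTangent φ} (hp : φ p.1 ∈ e.source) {F G : RestrictedTangent φ → ℝ}
    (hF : MDifferentiableAt (𝓘(ℝ, EX).prod 𝓘(ℝ, E)) 𝓘(ℝ, ℝ) F p)
    (hG : MDifferentiableAt (𝓘(ℝ, EX).prod 𝓘(ℝ, E)) 𝓘(ℝ, ℝ) G p) :
    mfderiv (𝓘(ℝ, EX).prod 𝓘(ℝ, E)) 𝓘(ℝ, ℝ) F p = mfderiv (𝓘(ℝ, EX).prod 𝓘(ℝ, E)) 𝓘(ℝ, ℝ) G p ↔
      dFun (EX := EX) (fun x => F (frameMap φ e (x, fibreCoord φ e p))) p.1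
        = dFun (EX := EX) (fun x => G (frameMap φ e (x, fibreCoord φ e p))) p.1 ∧
      fderiv ℝ (fun v => F (frameMap φ e (p.1, v))) (fibreCoord φ e p)
        = fderiv ℝ (fun v => G (frameMap φ e (p.1, v))) (fibreCoord φ e p) := by
  set v₀ := fibreCoord φ e p with hv₀
  have hp₀ : frameMap φ e (p.1, v₀) = p := frameMap_fibreCoord he hp
  have hΨ := (contMDiffAt_frameMap he (p := (p.1, v₀)) hp).mdifferentiableAt (by simp)
  have hF' : MDifferentiableAt (𝓘(ℝ, EX).prod 𝓘(ℝ, E)) 𝓘(ℝ, ℝ) F (frameMap φ e (p.1, v₀)) := by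
    rwa [hp₀]
  have hG' : MDifferentiableAt (𝓘(ℝ, EX).prod 𝓘(ℝ, E)) 𝓘(ℝ, ℝ) G (frameMap φ e (p.1, v₀)) := by
    rwa [hp₀]
  have hFΨ := hF'.comp (p.1, v₀) hΨ
  have hGΨ := hG'.comp (p.1, v₀) hΨ
  have key : mfderiv (𝓘(ℝ, EX).prod 𝓘(ℝ, E)) 𝓘(ℝ, ℝ) F p
        = mfderiv (𝓘(ℝ, EX).prod 𝓘(ℝ, E)) 𝓘(ℝ, ℝ) G p ↔
      mfderiv (𝓘(ℝ, EX).prod 𝓘(ℝ, E)) 𝓘(ℝ, ℝ) (F ∘ frameMap φ e) (p.1, v₀)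
        = mfderiv (𝓘(ℝ, EX).prod 𝓘(ℝ, E)) 𝓘(ℝ, ℝ) (G ∘ frameMap φ e) (p.1, v₀) := by
    constructor
    · intro h
      rw [mfderiv_comp (p.1, v₀) hF' hΨ, mfderiv_comp (p.1, v₀) hG' hΨ, hp₀, h]
      rfl
    · intro h
      -- This map is the local inverse of the frame map, so equality of differentials can be
      -- transported back.
      have hΘ : MDifferentiableAt (𝓘(ℝ, EX).prod 𝓘(ℝ, E)) (𝓘(ℝ, EX).prod 𝓘(ℝ, E))
          (fun q : RestrictedTangent φ => (q.1, fibreCoord φ e q)) p :=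
        ((contMDiffAt_proj (n := ∞) (φ *ᵖ (TangentSpace 𝓘(ℝ, E) : M → Type _))).prodMk
          (contMDiffAt_fibreCoord he hp)).mdifferentiableAt (by simp)
      have hev : ∀ F : RestrictedTangent φ → ℝ, F =ᶠ[𝓝 p]
          (F ∘ frameMap φ e) ∘ (fun q : RestrictedTangent φ => (q.1, fibreCoord φ e q)) := by
        intro F
        have hcont : ContinuousAt (fun q : RestrictedTangent φ => φ q.1) p :=
          φ.contMDiff.continuous.continuousAt.comp
            (contMDiffAt_proj (IB := 𝓘(ℝ, EX)) (n := ∞)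
              (φ *ᵖ (TangentSpace 𝓘(ℝ, E) : M → Type _))).continuousAt
        filter_upwards [hcont.preimage_mem_nhds (e.open_source.mem_nhds hp)] with q hq
        exact congrArg F (frameMap_fibreCoord he hq).symm
      rw [(hev F).mfderiv_eq, (hev G).mfderiv_eq, mfderiv_comp p hFΨ hΘ, mfderiv_comp p hGΨ hΘ, h]
      rfl
  rw [key]
  have hadd : ∀ {F : RestrictedTangent φ → ℝ}, MDifferentiableAt (𝓘(ℝ, EX).prod 𝓘(ℝ, E)) 𝓘(ℝ, ℝ)
      (F ∘ frameMap φ e) (p.1, v₀) → ∀ (ξ : EX) (w : E),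
      (mfderiv (𝓘(ℝ, EX).prod 𝓘(ℝ, E)) 𝓘(ℝ, ℝ) (F ∘ frameMap φ e) (p.1, v₀) : EX × E →L[ℝ] ℝ)
        (ξ, w) = dFun (EX := EX) (fun x => F (frameMap φ e (x, v₀))) p.1 ξ
          + fderiv ℝ (fun v => F (frameMap φ e (p.1, v))) v₀ w := by
    intro F hF ξ w
    rw [← mfderiv_eq_fderiv]
    exact mfderiv_prod_eq_add_apply (v := (ξ, w)) hF
  constructor
  · intro h
    have hc : ∀ (ξ : EX) (w : E), _ := fun ξ w => (hadd hFΨ ξ w).symm.trans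
      ((congrArg (fun L : EX × E →L[ℝ] ℝ => L (ξ, w)) h).trans (hadd hGΨ ξ w))
    exact ⟨by ext ξ; simpa using! hc ξ 0, by ext w; simpa using! hc 0 w⟩
  · rintro ⟨h1, h2⟩
    refine ContinuousLinearMap.ext fun ⟨ξ, w⟩ => (hadd hFΨ ξ w).trans ?_
    rw [h1, h2]
    exact (hadd hGΨ ξ w).symm

end RestrictedTangentCharts

/-! ### Slice charts of embedded submanifolds. -/

section Slices

variable {E : Type*} [NormedAddCommGroup E] [NormedSpace ℝ E]
  {M : Type*} [TopologicalSpace M] [ChartedSpace E M]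
  {E' : Type*} [NormedAddCommGroup E'] [NormedSpace ℝ E']
  {N : Type*} [TopologicalSpace N] [ChartedSpace E' N]

/-- Charts `e` of `M` and `d` of `N` around `ι n` and `n` in which the embedded submanifold
`ι : N → M` is the range of a linear map `B` with left inverse `A`. -/
structure SliceChart (ι : SmoothMap E' N E M) (n : N) where
  e : OpenPartialHomeomorph M E
  d : OpenPartialHomeomorph N E'
  A : E →L[ℝ] E'
  B : E' →L[ℝ] E
  he : e ∈ IsManifold.maximalAtlas 𝓘(ℝ, E) ∞ M
  hd : d ∈ IsManifold.maximalAtlas 𝓘(ℝ, E') ∞ N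
  hAB : ∀ y, A (B y) = y
  mem : ι n ∈ e.source
  mem_source : ∀ n', ι n' ∈ e.source → n' ∈ d.source
  map_eq : ∀ n', ι n' ∈ e.source → e (ι n') = B (d n')
  proj_mem : ∀ z ∈ e.source, A (e z) ∈ d.target

/-- The immersion normal form supplies the charts, the linear inclusion and its left inverse; the
topological embedding allows the ambient chart to be shrunk until no other sheet of `N` enters it.
-/
theorem IsSubmanifold.exists_sliceChart [IsManifold 𝓘(ℝ, E) ∞ M] {ι : SmoothMap E' N E M}
    (hι : IsSubmanifold ι) (n : N) : Nonempty (SliceChart ι n) := by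
  have h := hι.isImmersion.isImmersionAt n
  set A : E →L[ℝ] E' := (ContinuousLinearMap.fst ℝ E' h.complement).comp
    (h.equiv.symm : E →L[ℝ] E' × h.complement) with hA
  set B : E' →L[ℝ] E := (h.equiv : E' × h.complement →L[ℝ] E).comp
    (ContinuousLinearMap.inl ℝ E' h.complement) with hB
  have hAB : ∀ y, A (B y) = y := by intro y; simp [hA, hB]
  have hmap : ∀ n' ∈ h.domChart.source, h.codChart (ι n') = B (h.domChart n') := by
    intro n' hn'
    have h0 : h.domChart n' ∈ (h.domChart.extend 𝓘(ℝ, E')).target := by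
      simpa only [mfld_simps] using h.domChart.map_source hn'
    have h1 := h.writtenInCharts h0
    simpa [mfld_simps, hB, h.domChart.left_inv hn'] using h1
  obtain ⟨V, hV, hVeq⟩ := hι.isEmbedding.isInducing.isOpen_iff.1 h.domChart.open_source
  have hopen : IsOpen (h.codChart.source ∩ h.codChart ⁻¹' (A ⁻¹' h.domChart.target)) :=
    h.codChart.isOpen_inter_preimage (h.domChart.open_target.preimage A.continuous)
  -- `V` excludes points of `N` outside the domain chart; the preimage condition makes the linear
  -- projection land in the target of that chart, so that a retraction is defined on `W`.
  set W := V ∩ (h.codChart.source ∩ h.codChart ⁻¹' (A ⁻¹' h.domChart.target)) with hW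
  have hWo : IsOpen W := hV.inter hopen
  have hdom : ∀ n', ι n' ∈ V → n' ∈ h.domChart.source := by
    intro n' hn'; rw [← hVeq]; exact hn'
  have hsrc : (h.codChart.restr W).source = W := by
    rw [h.codChart.restr_source' W hWo, inter_eq_right]
    exact fun z hz => hz.2.1
  refine ⟨⟨h.codChart.restr W, h.domChart, A, B, ?_, h.domChart_mem_maximalAtlas, hAB, ?_, ?_, ?_,
    ?_⟩⟩
  · exact restr_mem_maximalAtlas (contDiffGroupoid ∞ 𝓘(ℝ, E)) h.codChart_mem_maximalAtlas hWo
  · rw [hsrc]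
    refine ⟨?_, h.mem_codChart_source, ?_⟩
    · have := h.mem_domChart_source; rw [← hVeq] at this; exact this
    · simp only [mem_preimage]
      rw [hmap n h.mem_domChart_source, hAB]
      exact h.domChart.map_source h.mem_domChart_source
  · intro n' hn'
    rw [hsrc] at hn'
    exact hdom n' hn'.1
  · intro n' hn'
    rw [hsrc] at hn'
    exact hmap n' (hdom n' hn'.1)
  · intro z hz
    rw [hsrc] at hz
    exact hz.2.2

namespace SliceChart

variable {ι : SmoothMap E' N E M} {n : N} (c : SliceChart ι n) {n' : N}

theorem dChart_tangentAt (h : ι n' ∈ c.e.source) (u : TangentSpace 𝓘(ℝ, E') n') :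
    dChart c.e (ι n') (tangentAt ι n' u) = c.B (dChart c.d n' u) := by
  have hn := c.mem_source n' h
  have h1 : (c.e ∘ ι) =ᶠ[𝓝 n'] (c.B ∘ c.d) := by
    filter_upwards [ι.contMDiff.continuous.continuousAt.preimage_mem_nhds
      (c.e.open_source.mem_nhds h)] with m hm
    exact c.map_eq m hm
  have h2 := h1.mfderiv_eq (I := 𝓘(ℝ, E')) (I' := 𝓘(ℝ, E))
  rw [mfderiv_comp n' (mdifferentiableAt_chart c.he h)
    (ι.contMDiff.mdifferentiableAt (by simp)), mfderiv_comp n'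
    c.B.differentiableAt.mdifferentiableAt (mdifferentiableAt_chart c.hd hn),
    mfderiv_eq_fderiv, c.B.fderiv] at h2
  exact DFunLike.congr_fun h2 u

theorem tangentAt_dChartInv (h : ι n' ∈ c.e.source) (v : E') :
    tangentAt ι n' (dChartInv c.d n' v) = dChartInv c.e (ι n') (c.B v) := by
  have h1 := c.dChart_tangentAt h (dChartInv c.d n' v)
  rw [dChart_dChartInv c.hd (c.mem_source n' h)] at h1
  rw [← h1, dChartInv_dChart c.he h]

theorem tangentAt_injective (h : ι n' ∈ c.e.source) : Function.Injective (tangentAt ι n') := by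
  intro u v huv
  have h1 := c.dChart_tangentAt h u
  rw [huv, c.dChart_tangentAt h v] at h1
  have h2 := congrArg c.A h1
  rw [c.hAB, c.hAB] at h2
  have h3 := congrArg (dChartInv c.d n') h2
  rwa [dChartInv_dChart c.hd (c.mem_source n' h), dChartInv_dChart c.hd (c.mem_source n' h),
    eq_comm] at h3

end SliceChart

theorem IsSubmanifold.tangentAt_injective [IsManifold 𝓘(ℝ, E) ∞ M] {ι : SmoothMap E' N E M}
    (hι : IsSubmanifold ι) (n : N) : Function.Injective (tangentAt ι n) := by
  obtain ⟨c⟩ := hι.exists_sliceChart n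
  exact c.tangentAt_injective c.mem

end Slices

/-! ### Smoothness of the Hessian and its descent to the normal bundle. -/

section VerticalJet

variable {E : Type*} [NormedAddCommGroup E] [NormedSpace ℝ E]
  {M : Type*} [TopologicalSpace M] [ChartedSpace E M] [IsManifold 𝓘(ℝ, E) ∞ M]
  {EX : Type*} [NormedAddCommGroup EX] [NormedSpace ℝ EX]
  {X : Type*} [TopologicalSpace X] [ChartedSpace EX X]
  {φ : SmoothMap EX X E M} {e : OpenPartialHomeomorph M E}

theorem contMDiffAt_base (p : RestrictedTangent φ) :
    ContMDiffAt (𝓘(ℝ, EX).prod 𝓘(ℝ, E)) 𝓘(ℝ, E) ∞ (fun q : RestrictedTangent φ => φ q.1) p :=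
  φ.contMDiff.contMDiffAt.comp p (contMDiffAt_proj (φ *ᵖ (TangentSpace 𝓘(ℝ, E) : M → Type _)))

omit [IsManifold 𝓘(ℝ, E) ∞ M] in
theorem generator_eq (he : e ∈ IsManifold.maximalAtlas 𝓘(ℝ, E) ∞ M) {p : RestrictedTangent φ}
    (hp : φ p.1 ∈ e.source) (f h : SmoothFn E M) :
    generator φ f h p = f (φ p.1) + fderiv ℝ (h ∘ e.symm) (e (φ p.1)) (fibreCoord φ e p) :=
  congrArg (f (φ p.1) + ·) (dAt_eq he hp h p.2)

theorem contMDiff_generator (f h : SmoothFn E M) :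
    ContMDiff (𝓘(ℝ, EX).prod 𝓘(ℝ, E)) 𝓘(ℝ, ℝ) ∞ (generator φ f h) := by
  intro p
  set e := chartAt E (φ p.1)
  have he : e ∈ IsManifold.maximalAtlas 𝓘(ℝ, E) ∞ M := IsManifold.chart_mem_maximalAtlas _
  have hz : φ p.1 ∈ e.source := mem_chart_source E _
  have h1 := contDiffAt_fderiv (contDiffAt_comp_chart_symm he hz h.contMDiff.contMDiffAt)
  have h2 : ContMDiffAt (𝓘(ℝ, EX).prod 𝓘(ℝ, E)) 𝓘(ℝ, E →L[ℝ] ℝ) ∞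
      (fun q : RestrictedTangent φ => fderiv ℝ (h ∘ e.symm) (e (φ q.1))) p :=
    ContMDiffAt.comp p h1.contMDiffAt
      ((contMDiffAt_of_mem_maximalAtlas he hz).comp p (contMDiffAt_base p))
  refine ((f.contMDiff.contMDiffAt.comp p (contMDiffAt_base p)).add
    (h2.clm_apply (contMDiffAt_fibreCoord he hz))).congr_of_eventuallyEq ?_
  filter_upwards [(contMDiffAt_base p).continuousAt.preimage_mem_nhds (e.open_source.mem_nhds hz)]
    with q hq
  exact generator_eq he hq f h

/-- The second derivative at critical points is a smooth function on `TM|_X`. -/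
theorem contMDiffAt_hessAt (H : SmoothFn E M) {p : RestrictedTangent φ}
    (h0 : ∀ᶠ x in 𝓝 p.1, dAt H (φ x) = 0) :
    ContMDiffAt (𝓘(ℝ, EX).prod 𝓘(ℝ, E)) 𝓘(ℝ, ℝ) ∞
      (fun q : RestrictedTangent φ => hessAt H (φ q.1) q.2 q.2) p := by
  set e := chartAt E (φ p.1)
  have he : e ∈ IsManifold.maximalAtlas 𝓘(ℝ, E) ∞ M := IsManifold.chart_mem_maximalAtlas _
  have hz : φ p.1 ∈ e.source := mem_chart_source E _
  have h1 := contDiffAt_fderiv (contDiffAt_fderiv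
    (contDiffAt_comp_chart_symm he hz (H.contMDiff.contMDiffAt (x := φ p.1))))
  have h2 : ContMDiffAt (𝓘(ℝ, EX).prod 𝓘(ℝ, E)) 𝓘(ℝ, E →L[ℝ] E →L[ℝ] ℝ) ∞
      (fun q : RestrictedTangent φ => fderiv ℝ (fderiv ℝ (H ∘ e.symm)) (e (φ q.1))) p :=
    ContMDiffAt.comp p h1.contMDiffAt
      ((contMDiffAt_of_mem_maximalAtlas he hz).comp p (contMDiffAt_base p))
  have h3 := contMDiffAt_fibreCoord he hz
  refine ((h2.clm_apply h3).clm_apply h3).congr_of_eventuallyEq ?_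
  have hπ : ContinuousAt (fun q : RestrictedTangent φ => q.1) p :=
    (contMDiffAt_proj (IB := 𝓘(ℝ, EX)) (n := ∞)
      (φ *ᵖ (TangentSpace 𝓘(ℝ, E) : M → Type _))).continuousAt
  filter_upwards [(contMDiffAt_base p).continuousAt.preimage_mem_nhds (e.open_source.mem_nhds hz),
    hπ.eventually h0] with q hq hq0
  exact hessAt_eq_chart he hq H hq0 _ _

/-- The bilinear form on a quotient space induced by a bilinear form. -/
def descendForm {V : Type*} [AddCommGroup V] [Module ℝ V] (W : Submodule ℝ V)
    (β : V →ₗ[ℝ] V →ₗ[ℝ] ℝ) (hl : ∀ u ∈ W, ∀ v, β u v = 0) (hr : ∀ u, ∀ v ∈ W, β u v = 0) :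
    V ⧸ W →ₗ[ℝ] V ⧸ W →ₗ[ℝ] ℝ :=
  W.liftQ
    { toFun := fun u => W.liftQ (β u) (hr u)
      map_add' := fun u v => by
        apply Submodule.linearMap_qext; ext w
        change β (u + v) w = β u w + β v w
        rw [map_add]; rfl
      map_smul' := fun r u => by
        apply Submodule.linearMap_qext; ext w
        change β (r • u) w = r • β u w
        rw [map_smul]; rfl }
    (fun u hu => by
      rw [LinearMap.mem_ker]
      apply Submodule.linearMap_qext; ext w
      exact hl u hu w)

/-- The field of symmetric forms on the normal bundle induced by the second derivative of `H`. -/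
def verticalJet (φ : SmoothMap EX X E M) (H : SmoothFn E M) (h0 : ∀ x, dAt H (φ x) = 0) :
    SymmetricField φ where
  form x := descendForm (tangentRange φ x)
    (ContinuousLinearMap.coeLM ℝ ∘ₗ (hessAt H (φ x)).toLinearMap)
    (fun _ hu v => hessAt_tangent_left φ H (Eventually.of_forall h0) hu v)
    (fun u v hv => (hessAt_symm H u v).trans
      (hessAt_tangent_left φ H (Eventually.of_forall h0) hv u))
  symm x u v := by
    induction u using Submodule.Quotient.induction_on with | H u =>
    induction v using Submodule.Quotient.induction_on with | H v =>
    exact hessAt_symm H u v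
  smooth := fun p => contMDiffAt_hessAt H (Eventually.of_forall h0)

theorem isVerticalJet_verticalJet (H : SmoothFn E M) (h0 : ∀ x, dAt H (φ x) = 0) :
    IsVerticalJet φ H (verticalJet φ H h0) :=
  fun _ _ _ => rfl

theorem IsVerticalJet.unique {H : SmoothFn E M} {j j' : SymmetricField φ}
    (hj : IsVerticalJet φ H j) (hj' : IsVerticalJet φ H j') : j' = j := by
  ext x u v
  exact (hj' x u v).trans (hj x u v).symm

end VerticalJet

/-! ### Extension of functions from submanifolds, and conormal covectors. -/

section Extension

variable {E : Type*} [NormedAddCommGroup E] [NormedSpace ℝ E] [FiniteDimensional ℝ E]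
  {M : Type*} [TopologicalSpace M] [ChartedSpace E M] [IsManifold 𝓘(ℝ, E) ∞ M] [T2Space M]

/-- Multiply by a bump function supported in `U`. The last clause is what turns local functions
vanishing on a submanifold into global constraints. -/
theorem exists_smoothFn_eventuallyEq {U : Set M} (hU : IsOpen U) {z : M} (hz : z ∈ U)
    {f : M → ℝ} (hf : ∀ y ∈ U, ContMDiffAt 𝓘(ℝ, E) 𝓘(ℝ, ℝ) ∞ f y) :
    ∃ g : SmoothFn E M, g =ᶠ[𝓝 z] f ∧ ∀ y, (y ∈ U → f y = 0) → g y = 0 := by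
  obtain ⟨χ, hχ, -⟩ := (SmoothBumpFunction.nhds_basis_support (I := 𝓘(ℝ, E))
    (hU.mem_nhds hz)).mem_iff.1 (hU.mem_nhds hz)
  refine ⟨⟨fun y => χ y * f y, contMDiff_of_tsupport fun y hy => ?_⟩, ?_, ?_⟩
  · exact χ.contMDiff.contMDiffAt.mul (hf y (hχ (tsupport_mul_subset_left hy)))
  · filter_upwards [χ.eventuallyEq_one] with y hy
    change χ y * f y = f y
    rw [hy]; simp
  · intro y hy
    change χ y * f y = 0
    by_cases hyU : y ∈ U
    · rw [hy hyU, mul_zero]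
    · rw [image_eq_zero_of_notMem_tsupport fun h => hyU (hχ h), zero_mul]

/-- A linear function of the coordinates extends to a global smooth function. -/
theorem exists_smoothFn_chart {e : OpenPartialHomeomorph M E}
    (he : e ∈ IsManifold.maximalAtlas 𝓘(ℝ, E) ∞ M) {z : M} (hz : z ∈ e.source) (l : E →L[ℝ] ℝ) :
    ∃ g : SmoothFn E M, g =ᶠ[𝓝 z] (fun y => l (e y)) ∧ (∀ u, dAt g z u = l (dChart e z u)) ∧
      ∀ y, (y ∈ e.source → l (e y) = 0) → g y = 0 := by
  obtain ⟨g, hg, hg0⟩ := exists_smoothFn_eventuallyEq (f := fun y => l (e y)) e.open_source hz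
    (fun y hy => l.contMDiff.contMDiffAt.comp y (contMDiffAt_of_mem_maximalAtlas he hy))
  refine ⟨g, hg, fun u => ?_, hg0⟩
  have h1 : dAt g z = mfderiv 𝓘(ℝ, E) 𝓘(ℝ, ℝ) (l ∘ e) z := hg.mfderiv_eq
  rw [h1, mfderiv_comp z l.differentiableAt.mdifferentiableAt (mdifferentiableAt_chart he hz),
    mfderiv_eq_fderiv, l.fderiv]
  rfl

theorem exists_dAt_eq (z : M) (α : Cotangent E z) : ∃ f : SmoothFn E M, dAt f z = α := by
  have he : chartAt E z ∈ IsManifold.maximalAtlas 𝓘(ℝ, E) ∞ M := IsManifold.chart_mem_maximalAtlas _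
  have hz := mem_chart_source E z
  obtain ⟨f, -, hf, -⟩ := exists_smoothFn_chart he hz (α.comp (dChartInv (chartAt E z) z))
  refine ⟨f, ContinuousLinearMap.ext fun u => ?_⟩
  rw [hf]
  exact congrArg α (dChartInv_dChart he hz u)

variable {E' : Type*} [NormedAddCommGroup E'] [NormedSpace ℝ E']
  {N : Type*} [TopologicalSpace N] [ChartedSpace E' N] {ι : SmoothMap E' N E M}

/-- The differentials of the constraints at a point exhaust the annihilator of the tangent
space. -/
def HasConormalFunctions (ι : SmoothMap E' N E M) : Prop :=
  ∀ n, ∀ α ∈ annihilator ι n, ∃ f ∈ constraints ι, dAt f (ι n) = α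

/-- In a slice chart compose the covector with the projection `id - B ∘ A`: the result vanishes on
the slice, and since the covector already kills the range of `B` its differential is unchanged. -/
theorem IsSubmanifold.hasConormalFunctions (hι : IsSubmanifold ι) : HasConormalFunctions ι := by
  intro n α hα
  obtain ⟨c⟩ := hι.exists_sliceChart n
  obtain ⟨f, -, hf, hf0⟩ := exists_smoothFn_chart c.he c.mem
    ((α.comp (dChartInv c.e (ι n))).comp (ContinuousLinearMap.id ℝ E - c.B.comp c.A))
  refine ⟨f, fun n' => hf0 _ fun hn' => ?_, ContinuousLinearMap.ext fun u => ?_⟩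
  · simp [c.map_eq n' hn', c.hAB]
  · rw [hf]
    have h1 : α (dChartInv c.e (ι n) (c.B (c.A (dChart c.e (ι n) u)))) = 0 := by
      rw [← c.tangentAt_dChartInv c.mem]
      exact hα _ ⟨_, rfl⟩
    have h2 : α (dChartInv c.e (ι n) (dChart c.e (ι n) u)) = α u := by
      rw [dChartInv_dChart c.he c.mem]
    change α (dChartInv c.e (ι n) (dChart c.e (ι n) u - c.B (c.A (dChart c.e (ι n) u)))) = α u
    rw [map_sub, map_sub, h1, h2, sub_zero]

/-- The local retraction onto a submanifold defined by a slice chart. -/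
def SliceChart.retraction {n : N} (c : SliceChart ι n) (z : M) : N :=
  c.d.symm (c.A (c.e z))

omit [FiniteDimensional ℝ E] [IsManifold 𝓘(ℝ, E) ∞ M] [T2Space M] in
theorem SliceChart.contMDiffAt_retraction {n : N} (c : SliceChart ι n) {z : M}
    (hz : z ∈ c.e.source) : ContMDiffAt 𝓘(ℝ, E) 𝓘(ℝ, E') ∞ c.retraction z :=
  (contMDiffAt_symm_of_mem_maximalAtlas c.hd (c.proj_mem z hz)).comp z
    (c.A.contMDiff.contMDiffAt.comp z (contMDiffAt_of_mem_maximalAtlas c.he hz))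

omit [FiniteDimensional ℝ E] [IsManifold 𝓘(ℝ, E) ∞ M] [T2Space M] in
theorem SliceChart.retraction_map {n : N} (c : SliceChart ι n) {n' : N}
    (hn : ι n' ∈ c.e.source) : c.retraction (ι n') = n' := by
  rw [retraction, c.map_eq n' hn, c.hAB, c.d.left_inv (c.mem_source n' hn)]

/-- Local extension of a function on a submanifold, preserving zeros and critical points. -/
theorem IsSubmanifold.exists_extension (hι : IsSubmanifold ι) (n : N) (h : SmoothFn E' N) :
    ∃ g : SmoothFn E M, (∀ᶠ n' in 𝓝 n, g (ι n') = h n') ∧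
      (∀ᶠ n' in 𝓝 n, dAt h n' = 0 → dAt g (ι n') = 0) ∧ ∀ n', h n' = 0 → g (ι n') = 0 := by
  obtain ⟨c⟩ := hι.exists_sliceChart n
  obtain ⟨g, hg, hg0⟩ := exists_smoothFn_eventuallyEq (f := h ∘ c.retraction) c.e.open_source c.mem
    (fun y hy => h.contMDiff.contMDiffAt.comp y (c.contMDiffAt_retraction hy))
  have hcont : ContinuousAt ι n := ι.contMDiff.continuous.continuousAt
  have hsrc : ∀ᶠ n' in 𝓝 n, ι n' ∈ c.e.source :=
    hcont.preimage_mem_nhds (c.e.open_source.mem_nhds c.mem)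
  refine ⟨g, ?_, ?_, ?_⟩
  · filter_upwards [hcont.eventually hg, hsrc] with n' h1 h2
    rw [h1, Function.comp_apply, c.retraction_map h2]
  · filter_upwards [hcont.eventually hg.eventually_nhds, hsrc] with n' h1 h2 h3
    have h4 : dAt g (ι n') = mfderiv 𝓘(ℝ, E) 𝓘(ℝ, ℝ) (h ∘ c.retraction) (ι n') :=
      EventuallyEq.mfderiv_eq h1
    rw [h4, mfderiv_comp (ι n') (h.contMDiff.mdifferentiableAt (by simp))
      ((c.contMDiffAt_retraction h2).mdifferentiableAt (by simp))]
    have h5 : mfderiv 𝓘(ℝ, E') 𝓘(ℝ, ℝ) h (c.retraction (ι n')) = 0 := by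
      rw [c.retraction_map h2]; exact h3
    rw [h5]
    exact ContinuousLinearMap.zero_comp _
  · intro n' hn'
    refine hg0 _ fun h2 => ?_
    rw [Function.comp_apply, c.retraction_map h2, hn']

omit [FiniteDimensional ℝ E] [IsManifold 𝓘(ℝ, E) ∞ M] [T2Space M] in
theorem dAt_add (f g : SmoothFn E M) (z : M) : dAt (f + g) z = dAt f z + dAt g z :=
  mfderiv_add (f.contMDiff.mdifferentiableAt (by simp)) (g.contMDiff.mdifferentiableAt (by simp))

omit [FiniteDimensional ℝ E] [IsManifold 𝓘(ℝ, E) ∞ M] [T2Space M] in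
theorem dAt_tangentAt (g : SmoothFn E M) (h : SmoothFn E' N) {n : N}
    (hgh : ∀ᶠ n' in 𝓝 n, g (ι n') = h n') (u : TangentSpace 𝓘(ℝ, E') n) :
    dAt g (ι n) (tangentAt ι n u) = dAt h n u := by
  have h1 : (g ∘ ι) =ᶠ[𝓝 n] h := hgh
  have h2 := h1.mfderiv_eq (I := 𝓘(ℝ, E')) (I' := 𝓘(ℝ, ℝ))
  rw [mfderiv_comp n (g.contMDiff.mdifferentiableAt (by simp))
    (ι.contMDiff.mdifferentiableAt (by simp))] at h2
  exact DFunLike.congr_fun h2 u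

variable {EX : Type*} [NormedAddCommGroup EX] [NormedSpace ℝ EX]
  {X : Type*} [TopologicalSpace X] [ChartedSpace EX X] {ψ : SmoothMap EX X E' N}

/-- The restriction of the covector to TN is realised by a constraint `h` on `N`, extended to `g` on
`M`; the difference from `dg` is conormal to `N` and is realised by a function vanishing on all of
`N`. No slice chart for the composite is needed. -/
theorem HasConormalFunctions.comp (hψ : HasConormalFunctions ψ) (hι : IsSubmanifold ι) :
    HasConormalFunctions (ι.comp ψ) := by
  intro x (α : Cotangent E (ι (ψ x))) hα
  set β : Cotangent E' (ψ x) := α.comp (mfderiv 𝓘(ℝ, E') 𝓘(ℝ, E) ι (ψ x)) with hβ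
  have hβ0 : β ∈ annihilator ψ x := by
    intro u hu
    exact hα _ (tangentRange_le_comap ι ψ x hu)
  obtain ⟨h, hh0, hh⟩ := hψ x β hβ0
  obtain ⟨g, hg1, -, hg2⟩ := hι.exists_extension (ψ x) h
  have hγ : α - dAt g (ι (ψ x)) ∈ annihilator ι (ψ x) := by
    rintro _ ⟨u, rfl⟩
    have h1 := dAt_tangentAt g h hg1 u
    rw [hh] at h1
    change α (tangentAt ι (ψ x) u) - dAt g (ι (ψ x)) (tangentAt ι (ψ x) u) = 0
    rw [h1]
    exact sub_self _
  obtain ⟨f, hf0, hf⟩ := hι.hasConormalFunctions (ψ x) _ hγ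
  refine ⟨f + g, fun y => ?_, ?_⟩
  · change f (ι (ψ y)) + g (ι (ψ y)) = 0
    rw [hf0, hg2 _ (hh0 y), add_zero]
  · refine (dAt_add f g (ι (ψ x))).trans ?_
    rw [hf]
    exact sub_add_cancel _ _

end Extension

/-! ### The bivector field and its bracket in a chart. -/

section Bracket

variable {E : Type*} [NormedAddCommGroup E] [NormedSpace ℝ E] [FiniteDimensional ℝ E]
  {M : Type*} [TopologicalSpace M] [ChartedSpace E M]
  (w : BivectorField E M) {e : OpenPartialHomeomorph M E} {z : M}

/-- The bivector field in a chart. -/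
def BivectorField.coord (w : BivectorField E M) (e : OpenPartialHomeomorph M E) (y : E) :
    (E →L[ℝ] ℝ) →L[ℝ] E :=
  LinearMap.toContinuousLinearMap
    { toFun := fun l => dChart e (e.symm y) (w.sharp (e.symm y) (l.comp (dChart e (e.symm y))))
      map_add' := fun l m => by rw [ContinuousLinearMap.add_comp, map_add, map_add]
      map_smul' := fun r l => by
        rw [ContinuousLinearMap.smul_comp, map_smul, map_smul]; rfl }

theorem BivectorField.coord_apply (hz : z ∈ e.source) (l : E →L[ℝ] ℝ) :
    w.coord e (e z) l = dChart e z (w.sharp z (l.comp (dChart e z))) := by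
  change dChart e (e.symm (e z)) (w.sharp (e.symm (e z)) (l.comp (dChart e (e.symm (e z))))) = _
  rw [e.left_inv hz]

theorem BivectorField.coord_skew {y : E} (l m : E →L[ℝ] ℝ) :
    l (w.coord e y m) = - m (w.coord e y l) :=
  w.skew (e.symm y) (l.comp (dChart e (e.symm y))) (m.comp (dChart e (e.symm y)))

omit [FiniteDimensional ℝ E] in
theorem dAt_eq_comp (he : e ∈ IsManifold.maximalAtlas 𝓘(ℝ, E) ∞ M) (hz : z ∈ e.source)
    (f : SmoothFn E M) : dAt f z = (fderiv ℝ (f ∘ e.symm) (e z)).comp (dChart e z) :=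
  ContinuousLinearMap.ext fun u => dAt_eq he hz f u

theorem BivectorField.dChart_ham (he : e ∈ IsManifold.maximalAtlas 𝓘(ℝ, E) ∞ M)
    (hz : z ∈ e.source) (g : SmoothFn E M) :
    dChart e z (w.sharp z (dAt g z)) = w.coord e (e z) (fderiv ℝ (g ∘ e.symm) (e z)) := by
  rw [w.coord_apply hz, dAt_eq_comp he hz]

theorem BivectorField.bracket_eq (he : e ∈ IsManifold.maximalAtlas 𝓘(ℝ, E) ∞ M)
    (hz : z ∈ e.source) (f g : SmoothFn E M) :
    w.bracket f g z = fderiv ℝ (f ∘ e.symm) (e z)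
      (w.coord e (e z) (fderiv ℝ (g ∘ e.symm) (e z))) := by
  rw [← w.dChart_ham he hz, ← dAt_eq he hz]; rfl

variable [IsManifold 𝓘(ℝ, E) ∞ M] [T2Space M]

/-- Smoothness is given only for brackets of global functions. Cut-off linear coordinates have
constant differential near a point, so their brackets are locally the matrix coefficients of the
bivector. -/
theorem BivectorField.contDiffAt_coord (he : e ∈ IsManifold.maximalAtlas 𝓘(ℝ, E) ∞ M)
    (hz : z ∈ e.source) : ContDiffAt ℝ ∞ (w.coord e) (e z) := by
  have hmain : ∀ l m : E →L[ℝ] ℝ, ContDiffOn ℝ ∞ (fun y => l (w.coord e y m)) e.target := by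
    intro l m y hy
    obtain ⟨z, hz, rfl⟩ : ∃ z ∈ e.source, e z = y := ⟨e.symm y, e.map_target hy, e.right_inv hy⟩
    obtain ⟨f, hf, -⟩ := exists_smoothFn_chart he hz l
    obtain ⟨g, hg, -⟩ := exists_smoothFn_chart he hz m
    have h1 := contDiffAt_comp_chart_symm he hz ((w.bracket f g).contMDiff.contMDiffAt)
    refine (h1.congr_of_eventuallyEq ?_).contDiffWithinAt
    have hcont : Tendsto e.symm (𝓝 (e z)) (𝓝 z) := by
      have := e.continuousAt_symm hy
      rwa [ContinuousAt, e.left_inv hz] at this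
    have hlin : ∀ {f : SmoothFn E M} {l : E →L[ℝ] ℝ}, f =ᶠ[𝓝 z] (fun y => l (e y)) →
        ∀ᶠ y in 𝓝 (e z), fderiv ℝ (f ∘ e.symm) y = l := by
      intro f l hf
      filter_upwards [(hcont.eventually hf).eventually_nhds, (e.open_target.mem_nhds hy)]
        with y' h1 h2
      have h3 : (f ∘ e.symm) =ᶠ[𝓝 y'] l := by
        filter_upwards [h1, e.open_target.mem_nhds h2] with y h3 h4
        simpa [e.right_inv h4] using h3
      rw [h3.fderiv_eq, l.fderiv]
    filter_upwards [hlin hf, hlin hg, e.open_target.mem_nhds hy] with y' h1 h2 h3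
    have h4 := w.bracket_eq he (e.map_target h3) f g
    rw [e.right_inv h3, h1, h2] at h4
    exact h4.symm
  have h : ContDiffOn ℝ ∞ (w.coord e) e.target := by
    rw [contDiffOn_clm_apply]
    intro m
    rw [← (Module.finBasis ℝ E).equivFunL.comp_contDiffOn_iff, contDiffOn_pi]
    intro i
    exact hmain ((ContinuousLinearMap.proj (R := ℝ) (φ := fun _ => ℝ) i).comp
      ((Module.finBasis ℝ E).equivFunL : E →L[ℝ] _)) m
  exact h.contDiffAt (e.open_target.mem_nhds (e.map_source hz))

end Bracket

/-! ### Representing differentials on the normal bundle by generators. -/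

section SameDifferential

variable {E : Type*} [NormedAddCommGroup E] [NormedSpace ℝ E]
  {M : Type*} [TopologicalSpace M] [ChartedSpace E M]
  {EX : Type*} [NormedAddCommGroup EX] [NormedSpace ℝ EX]
  {X : Type*} [TopologicalSpace X] [ChartedSpace EX X]
  {φ : SmoothMap EX X E M} {e : OpenPartialHomeomorph M E} {x : X}

theorem dFun_congr {f g : X → ℝ} (h : f =ᶠ[𝓝 x] g) : dFun (EX := EX) f x = dFun g x :=
  h.mfderiv_eq

theorem dFun_comp_chart (he : e ∈ IsManifold.maximalAtlas 𝓘(ℝ, E) ∞ M) (hx : φ x ∈ e.source)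
    {k : E → ℝ} (hk : DifferentiableAt ℝ k (e (φ x))) (ξ : EX) :
    dFun (EX := EX) (fun y => k (e (φ y))) x ξ
      = fderiv ℝ k (e (φ x)) (dChart e (φ x) (tangentAt φ x ξ)) := by
  have hφ := φ.contMDiff.mdifferentiableAt (x := x) (by simp)
  have h1 := mfderiv_comp x (g := k) (f := e ∘ φ) hk.mdifferentiableAt
    ((mdifferentiableAt_chart he hx).comp x hφ)
  rw [mfderiv_comp x (mdifferentiableAt_chart he hx) hφ, mfderiv_eq_fderiv] at h1
  exact DFunLike.congr_fun h1 ξ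

theorem generator_frameMap (he : e ∈ IsManifold.maximalAtlas 𝓘(ℝ, E) ∞ M) (hx : φ x ∈ e.source)
    (f h : SmoothFn E M) (v : E) :
    generator φ f h (frameMap φ e (x, v))
      = (f ∘ e.symm) (e (φ x)) + fderiv ℝ (h ∘ e.symm) (e (φ x)) v := by
  rw [Function.comp_apply, e.left_inv hx]
  exact congrArg (f (φ x) + ·) (dAt_dChartInv he hx h v)

theorem dFun_generator (he : e ∈ IsManifold.maximalAtlas 𝓘(ℝ, E) ∞ M) (hx : φ x ∈ e.source)
    (f h : SmoothFn E M) (v : E) (ξ : EX) :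
    dFun (EX := EX) (fun y => generator φ f h (frameMap φ e (y, v))) x ξ
      = fderiv ℝ (f ∘ e.symm) (e (φ x)) (dChart e (φ x) (tangentAt φ x ξ))
        + fderiv ℝ (fderiv ℝ (h ∘ e.symm)) (e (φ x)) (dChart e (φ x) (tangentAt φ x ξ)) v := by
  have hf := (contDiffAt_comp_chart_symm he hx f.contMDiff.contMDiffAt).differentiableAt (by simp)
  have hh := (contDiffAt_fderiv (contDiffAt_comp_chart_symm he hx
    h.contMDiff.contMDiffAt)).differentiableAt (by simp)
  have hhv := hh.clm_apply (differentiableAt_const v)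
  have h1 : (fun y => generator φ f h (frameMap φ e (y, v))) =ᶠ[𝓝 x]
      fun y => (fun z => (f ∘ e.symm) z + fderiv ℝ (h ∘ e.symm) z v) (e (φ y)) := by
    filter_upwards [φ.contMDiff.continuous.continuousAt.preimage_mem_nhds
      (e.open_source.mem_nhds hx)] with y hy
    exact generator_frameMap he hy f h v
  rw [dFun_congr h1, dFun_comp_chart he hx (hf.fun_add hhv), fderiv_fun_add hf hhv,
    fderiv_clm_apply hh (differentiableAt_const v)]
  simp

theorem fderiv_generator (he : e ∈ IsManifold.maximalAtlas 𝓘(ℝ, E) ∞ M) (hx : φ x ∈ e.source)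
    (f h : SmoothFn E M) (v : E) :
    fderiv ℝ (fun v => generator φ f h (frameMap φ e (x, v))) v
      = fderiv ℝ (h ∘ e.symm) (e (φ x)) := by
  have h1 : (fun v => generator φ f h (frameMap φ e (x, v)))
      = fun v => (f ∘ e.symm) (e (φ x)) + fderiv ℝ (h ∘ e.symm) (e (φ x)) v :=
    funext fun v => generator_frameMap he hx f h v
  rw [h1, fderiv_const_add, ContinuousLinearMap.fderiv]

variable [IsManifold 𝓘(ℝ, E) ∞ M] {F : NormalBundle φ → ℝ} {p : RestrictedTangent φ}

/-- The differential splits into base and fibre parts in the frame of the chart. The fibre part sees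
only `dh`; the base part also contains the second derivative of `h`, since the coefficients of `dh`
vary along `X`. -/
theorem sameDifferential_iff (he : e ∈ IsManifold.maximalAtlas 𝓘(ℝ, E) ∞ M)
    (hp : φ p.1 ∈ e.source) (hF : IsSmoothOnNormal φ F) (f h : SmoothFn E M) :
    SameDifferential φ F p f h ↔ h ∈ constraints φ ∧
      (∀ ξ, fderiv ℝ (f ∘ e.symm) (e (φ p.1)) (dChart e (φ p.1) (tangentAt φ p.1 ξ))
        + fderiv ℝ (fderiv ℝ (h ∘ e.symm)) (e (φ p.1)) (dChart e (φ p.1) (tangentAt φ p.1 ξ))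
          (fibreCoord φ e p)
        = dFun (EX := EX) (fun y => F (toNormal φ (frameMap φ e (y, fibreCoord φ e p)))) p.1 ξ) ∧
      fderiv ℝ (h ∘ e.symm) (e (φ p.1))
        = fderiv ℝ (fun v => F (toNormal φ (frameMap φ e (p.1, v)))) (fibreCoord φ e p) := by
  rw [SameDifferential, mfderiv_eq_iff_frameMap he hp (hF.mdifferentiableAt (by simp))
    ((contMDiff_generator f h).mdifferentiableAt (by simp)), fderiv_generator he hp f h]
  refine and_congr_right fun _ => and_congr ?_ eq_comm
  rw [eq_comm, ContinuousLinearMap.ext_iff]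
  exact forall_congr' fun ξ => by rw [dFun_generator he hp f h]

theorem differentiableAt_frameMap (hF : IsSmoothOnNormal φ F)
    (he : e ∈ IsManifold.maximalAtlas 𝓘(ℝ, E) ∞ M) (hx : φ x ∈ e.source) (v : E) :
    DifferentiableAt ℝ (fun v => F (toNormal φ (frameMap φ e (x, v)))) v := by
  have h1 : ContMDiffAt 𝓘(ℝ, E) 𝓘(ℝ, ℝ) ∞ (fun v => F (toNormal φ (frameMap φ e (x, v)))) v :=
    (hF _).comp v ((contMDiffAt_frameMap he (p := (x, v)) hx).comp v
      (contMDiffAt_const.prodMk contMDiffAt_id))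
  exact (contMDiffAt_iff_contDiffAt.1 h1).differentiableAt (by simp)

/-- The fibre derivative is a conormal covector, hence some `dh` with `h` a constraint; then `f` is
chosen to correct the base derivative. This guarantees that the bracket formula has at least one
admissible choice of representatives. -/
theorem exists_sameDifferential [FiniteDimensional ℝ E] [T2Space M] (hφ : HasConormalFunctions φ)
    (hinj : ∀ x, Function.Injective (tangentAt φ x)) (hF : IsSmoothOnNormal φ F)
    (p : RestrictedTangent φ) : ∃ f h, SameDifferential φ F p f h := by
  set e := chartAt E (φ p.1)
  have he : e ∈ IsManifold.maximalAtlas 𝓘(ℝ, E) ∞ M := IsManifold.chart_mem_maximalAtlas _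
  have hz : φ p.1 ∈ e.source := mem_chart_source E _
  set k : E → ℝ := fun v => F (toNormal φ (frameMap φ e (p.1, v))) with hk
  set v₀ := fibreCoord φ e p with hv₀
  have hkd : DifferentiableAt ℝ k v₀ := differentiableAt_frameMap hF he hz v₀
  have hα : (fderiv ℝ k v₀).comp (dChart e (φ p.1)) ∈ annihilator φ p.1 := by
    intro u hu
    -- Translation by a vector of TX does not change the normal class, so `k` is constant in that
    -- direction.
    have hconst : ∀ t : ℝ, k (v₀ + t • dChart e (φ p.1) u) = k v₀ := by
      intro t
      refine congrArg F (congrArg (Sigma.mk p.1) ?_)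
      refine (Submodule.Quotient.eq _).2 ?_
      change dChartInv e (φ p.1) (v₀ + t • dChart e (φ p.1) u) - dChartInv e (φ p.1) v₀
        ∈ tangentRange φ p.1
      rw [map_add, map_smul, dChartInv_dChart he hz, add_sub_cancel_left]
      exact Submodule.smul_mem _ t hu
    have h1 := hkd.lineDeriv_eq_fderiv (v := dChart e (φ p.1) u)
    rw [lineDeriv] at h1
    simp only [hconst, deriv_const] at h1
    exact h1.symm
  obtain ⟨h, hh0, hh⟩ := hφ p.1 _ hα
  have hh' : fderiv ℝ (h ∘ e.symm) (e (φ p.1)) = fderiv ℝ k v₀ := by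
    ext v
    rw [← dAt_dChartInv he hz, hh]
    exact congrArg (fderiv ℝ k v₀) (dChart_dChartInv he hz v)
  obtain ⟨r, hr⟩ := LinearMap.exists_leftInverse_of_injective (tangentAt φ p.1)
    (LinearMap.ker_eq_bot.2 (hinj p.1))
  set T : EX →ₗ[ℝ] E := (dChart e (φ p.1)).toLinearMap ∘ₗ tangentAt φ p.1 with hT
  -- The base derivative left over once the contribution of `h` is removed; the left inverse `r` of
  -- the tangent map extends it to a covector on `M`.
  set η : EX →ₗ[ℝ] ℝ :=
    (dFun (EX := EX) (fun y => F (toNormal φ (frameMap φ e (y, v₀)))) p.1).toLinearMap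
      - ((fderiv ℝ (fderiv ℝ (h ∘ e.symm)) (e (φ p.1))).flip v₀).toLinearMap ∘ₗ T with hη
  obtain ⟨f, hf⟩ := exists_dAt_eq (φ p.1)
    (LinearMap.toContinuousLinearMap (η ∘ₗ (r : E →ₗ[ℝ] EX)) : E →L[ℝ] ℝ)
  refine ⟨f, h, (sameDifferential_iff he hz hF f h).2 ⟨hh0, fun ξ => ?_, hh'⟩⟩
  rw [← dAt_eq he hz, hf]
  have h2 : (η ∘ₗ (r : E →ₗ[ℝ] EX)) (tangentAt φ p.1 ξ) = η ξ :=
    congrArg η (DFunLike.congr_fun hr ξ)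
  have h3 : η ξ = dFun (EX := EX) (fun y => F (toNormal φ (frameMap φ e (y, v₀)))) p.1 ξ
    - fderiv ℝ (fderiv ℝ (h ∘ e.symm)) (e (φ p.1)) (dChart e (φ p.1) (tangentAt φ p.1 ξ)) v₀ := rfl
  change (η ∘ₗ (r : E →ₗ[ℝ] EX)) (tangentAt φ p.1 ξ) + _ = _
  rw [h2, h3, sub_add_cancel]

end SameDifferential

/-! ### Both notions of admissibility imply infinitesimal invariance. -/

section Characteristics

variable {E : Type*} [NormedAddCommGroup E] [NormedSpace ℝ E] [FiniteDimensional ℝ E]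
  {M : Type*} [TopologicalSpace M] [ChartedSpace E M]
  {E' : Type*} [NormedAddCommGroup E'] [NormedSpace ℝ E'] [FiniteDimensional ℝ E']
  {N : Type*} [TopologicalSpace N] [ChartedSpace E' N]
  {w : PoissonStructure E M} {ι : SmoothMap E' N E M}

omit [FiniteDimensional ℝ E] in
-- Picard–Lindelöf gives a differentiable solution, and the equation itself bootstraps its
-- regularity.
theorem exists_smooth_integral_curve {Y : E' → E'} {O : Set E'} (hO : IsOpen O)
    (hY : ContDiffOn ℝ ∞ Y O) {y₀ : E'} (hy₀ : y₀ ∈ O) :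
    ∃ δ > (0 : ℝ), ∃ γ : ℝ → E', γ 0 = y₀ ∧ ContDiffOn ℝ ∞ γ (Ioo (-δ) δ) ∧
      ∀ t ∈ Ioo (-δ) δ, γ t ∈ O ∧ HasDerivAt γ (Y (γ t)) t := by
  obtain ⟨γ, hγ0, ε, hε, hγ⟩ :=
    ((hY.contDiffAt (hO.mem_nhds hy₀)).of_le (by simp)
      ).exists_forall_mem_closedBall_exists_eq_forall_mem_Ioo_hasDerivAt₀ 0
  have hcont : ContinuousAt γ 0 := (hγ 0 (by constructor <;> linarith)).continuousAt
  have hev : ∀ᶠ t in 𝓝 0, γ t ∈ O := hcont.preimage_mem_nhds (hO.mem_nhds (by rwa [hγ0]))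
  obtain ⟨r, hr, hball⟩ := Metric.eventually_nhds_iff.1 hev
  -- Halving leaves room for the closed interval, on which the regularity theorem is applied.
  set δ := min ε r / 2 with hδ
  have hδ0 : 0 < δ := half_pos (lt_min hε hr)
  have hmem : ∀ t ∈ Icc (-δ) δ, γ t ∈ O ∧ HasDerivAt γ (Y (γ t)) t := by
    intro t ht
    have h1 : δ < ε := by
      have := min_le_left ε r; have := lt_min hε hr; simp only [hδ]; linarith
    have h2 : δ < r := by
      have := min_le_right ε r; have := lt_min hε hr; simp only [hδ]; linarith
    refine ⟨hball ?_, hγ t ⟨by linarith [ht.1], by linarith [ht.2]⟩⟩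
    rw [Real.dist_eq, sub_zero, abs_lt]
    exact ⟨by linarith [ht.1], by linarith [ht.2]⟩
  refine ⟨δ, hδ0, γ, hγ0, ?_, fun t ht => hmem t (Ioo_subset_Icc_self ht)⟩
  refine (ODE.contDiffOn_enat_Icc_of_hasDerivWithinAt (f := fun _ => Y) (u := O) (n := ⊤) ?_
    (fun t ht => (hmem t ht).2.hasDerivWithinAt) (fun t ht => (hmem t ht).1)).mono
    Ioo_subset_Icc_self
  exact hY.comp contDiffOn_snd fun p hp => hp.2

omit [FiniteDimensional ℝ E'] in
-- Otherwise a linear form vanishing on TN would separate this vector from TN; that form is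
-- conormal, against coisotropy.
theorem IsCoisotropic.sharp_mem_tangentRange (hco : IsCoisotropic w ι) {n : N}
    {α : Cotangent E (ι n)} (hα : α ∈ annihilator ι n) :
    w.sharp (ι n) α ∈ tangentRange ι n := by
  by_contra h
  obtain ⟨f, hf, hker⟩ := Submodule.exists_le_ker_of_notMem h
  have h1 := hco n (LinearMap.toContinuousLinearMap (f : E →ₗ[ℝ] ℝ) : E →L[ℝ] ℝ)
    (fun u hu => hker hu) α hα
  exact hf h1

/-- The function `H` on the coisotropic submanifold `ι : N → M` is annihilated by the
subcharacteristic distribution. -/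
def IsAnnihilatedBySubcharacteristic (w : PoissonStructure E M) (ι : SmoothMap E' N E M)
    (H : SmoothFn E' N) : Prop :=
  ∀ n, ∀ α ∈ annihilator ι n, ∀ u, tangentAt ι n u = w.sharp (ι n) α → dAt H n u = 0

variable [IsManifold 𝓘(ℝ, E) ∞ M] [T2Space M]

omit [FiniteDimensional ℝ E'] in
-- Every conormal covector is the differential of a constraint, so the idealizer condition, read
-- pointwise, is the claim.
theorem isAnnihilatedBySubcharacteristic_of_admissible (hι : IsSubmanifold ι)
    {H : SmoothFn E' N} (hH : H ∈ admissibleRestrictions w ι) :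
    IsAnnihilatedBySubcharacteristic w ι H := by
  obtain ⟨g, hg, hgH⟩ := hH
  intro n α hα u hu
  obtain ⟨f, hf, rfl⟩ := hι.hasConormalFunctions n α hα
  rw [← dAt_tangentAt (ι := ι) g H (Eventually.of_forall fun n' => (hgH n').symm), hu]
  exact hg f hf n

/-- Realise the covector as `df` for a constraint `f`. By coisotropy the Hamiltonian field of `f` is
tangent to `N`; its integral curve through `n` stays in a leaf, so `H` is constant along it and its
derivative at time 0 vanishes. -/
theorem isAnnihilatedBySubcharacteristic_of_constantOnLeaves (hι : IsSubmanifold ι)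
    (hco : IsCoisotropic w ι) {H : SmoothFn E' N} (hH : H ∈ constantOnLeaves w ι) :
    IsAnnihilatedBySubcharacteristic w ι H := by
  intro n α hα u hu
  obtain ⟨c⟩ := hι.exists_sliceChart n
  obtain ⟨f, hf, hfα⟩ := hι.hasConormalFunctions n α hα
  have hfann : ∀ n', dAt f (ι n') ∈ annihilator ι n' := by
    rintro n' _ ⟨v, rfl⟩
    have h1 := dAt_tangentAt (ι := ι) f 0 (n := n') (Eventually.of_forall fun n' => hf n') v
    rw [h1]
    have h2 : dAt (0 : SmoothFn E' N) n' = 0 := mfderiv_const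
    rw [h2]; rfl
  set fc : E → ℝ := f ∘ c.e.symm with hfc
  set Y : E' → E' := fun y => c.A (w.coord c.e (c.B y) (fderiv ℝ fc (c.B y))) with hY
  set O : Set E' := c.d.target ∩ c.d.symm ⁻¹' (ι ⁻¹' c.e.source) with hO
  have hOo : IsOpen O := c.d.symm.isOpen_inter_preimage
    (c.e.open_source.preimage ι.contMDiff.continuous)
  have hBy : ∀ y ∈ O, c.B y = c.e (ι (c.d.symm y)) := by
    intro y hy
    rw [c.map_eq _ hy.2, c.d.right_inv hy.1]
  have hYs : ContDiffOn ℝ ∞ Y O := by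
    intro y hy
    have h1 := w.contDiffAt_coord c.he hy.2
    have h2 := contDiffAt_fderiv (contDiffAt_comp_chart_symm c.he hy.2 f.contMDiff.contMDiffAt)
    rw [← hBy y hy] at h1 h2
    exact (c.A.contDiff.contDiffAt.comp y ((h1.clm_apply h2).comp y
      c.B.contDiff.contDiffAt)).contDiffWithinAt
  have hnd : n ∈ c.d.source := c.mem_source n c.mem
  have hy₀ : c.d n ∈ O := ⟨c.d.map_source hnd, by simpa [c.d.left_inv hnd] using c.mem⟩
  -- the hamiltonian vector field of the constraint, in the charts
  have hYham : ∀ y ∈ O, dChartInv c.e (ι (c.d.symm y)) (c.B (Y y))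
      = w.sharp (ι (c.d.symm y)) (dAt f (ι (c.d.symm y))) := by
    intro y hy
    have h1 := w.dChart_ham c.he hy.2 f
    rw [← hBy y hy] at h1
    obtain ⟨v, hv⟩ := hco.sharp_mem_tangentRange (hfann (c.d.symm y))
    rw [← hv, c.dChart_tangentAt hy.2] at h1
    have h2 : Y y = dChart c.d (c.d.symm y) v := by
      simp only [hY]
      rw [← h1, c.hAB]
    rw [h2, ← c.dChart_tangentAt hy.2, hv, dChartInv_dChart c.he hy.2]
  have hYu : Y (c.d n) = dChart c.d n u := by
    have h1 := w.dChart_ham c.he c.mem f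
    rw [hfα, ← hu, c.dChart_tangentAt c.mem, c.map_eq n c.mem] at h1
    simp only [hY]
    rw [← h1, c.hAB]
  obtain ⟨δ, hδ, γ, hγ0, hγs, hγ⟩ := exists_smooth_integral_curve hOo hYs hy₀
  have hleaf : ∀ s ∈ Ioo (-δ) δ, SameLeaf w ι n (c.d.symm (γ s)) := by
    intro s hs
    -- Rescaling time by `s` brings the arc from 0 to `s`, for either sign of `s`, to the unit
    -- interval.
    have hU : IsOpen ((fun t : ℝ => s * t) ⁻¹' Ioo (-δ) δ) :=
      isOpen_Ioo.preimage (continuous_const.mul continuous_id)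
    have hsm : ∀ t ∈ (fun t : ℝ => s * t) ⁻¹' Ioo (-δ) δ,
        ContMDiffAt 𝓘(ℝ, ℝ) 𝓘(ℝ, E') ∞ (fun t => γ (s * t)) t := by
      intro t ht
      rw [contMDiffAt_iff_contDiffAt]
      exact (hγs.contDiffAt (isOpen_Ioo.mem_nhds ht)).comp t (contDiffAt_const.mul contDiffAt_id)
    have hdsm : ∀ t ∈ (fun t : ℝ => s * t) ⁻¹' Ioo (-δ) δ,
        ContMDiffAt 𝓘(ℝ, E') 𝓘(ℝ, E') ∞ c.d.symm (γ (s * t)) := fun t ht =>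
      contMDiffAt_symm_of_mem_maximalAtlas c.hd (hγ _ ht).1.1
    have hsub : Icc (0 : ℝ) 1 ⊆ (fun t : ℝ => s * t) ⁻¹' Ioo (-δ) δ := by
      intro t ht
      have h1 : |s * t| < δ := by
        rw [abs_mul, abs_of_nonneg ht.1]
        exact (mul_le_of_le_one_right (abs_nonneg s) ht.2).trans_lt (abs_lt.2 hs)
      exact abs_lt.1 h1
    refine ⟨fun t => c.d.symm (γ (s * t)), _, hU, hsub, ?_, ?_, ?_, ?_⟩
    · intro t ht
      exact ((hdsm t ht).comp t (hsm t ht)).contMDiffWithinAt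
    · intro t ht
      have hst := hsub ht
      obtain ⟨hyO, hder⟩ := hγ _ hst
      have h1 : mfderiv 𝓘(ℝ, ℝ) 𝓘(ℝ, E') (fun t => c.d.symm (γ (s * t))) t (1 : ℝ)
          = dChartInv c.d (c.d.symm (γ (s * t))) (s • Y (γ (s * t))) := by
        have h2 := mfderiv_comp t ((hdsm t hst).mdifferentiableAt (by simp))
          ((hsm t hst).mdifferentiableAt (by simp))
        have h3 : HasDerivAt (fun t => γ (s * t)) (s • Y (γ (s * t))) t := by
          have := HasDerivAt.scomp t hder ((hasDerivAt_id t).const_mul s)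
          simpa [Function.comp_def] using this
        have h4 : mfderiv 𝓘(ℝ, ℝ) 𝓘(ℝ, E') (fun t => γ (s * t)) t (1 : ℝ)
            = s • Y (γ (s * t)) := by
          rw [mfderiv_eq_fderiv]
          exact h3.deriv
        have h5 := DFunLike.congr_fun h2 (1 : ℝ)
        refine h5.trans ?_
        refine (congrArg (mfderiv 𝓘(ℝ, E') 𝓘(ℝ, E') c.d.symm (γ (s * t))) h4).trans ?_
        unfold dChartInv
        rw [c.d.right_inv hyO.1]
        rfl
      rw [h1, c.tangentAt_dChartInv hyO.2, map_smul, map_smul, hYham _ hyO]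
      refine ⟨⟨s • dAt f _, ?_, map_smul _ _ _⟩, ?_⟩
      · intro v hv
        change s • dAt f _ v = 0
        rw [hfann _ v hv, smul_zero]
      · exact Submodule.smul_mem _ s (hco.sharp_mem_tangentRange (hfann _))
    · simp [hγ0, c.d.left_inv hnd]
    · simp
  -- the derivative along the integral curve vanishes
  have hconst : (fun s => (H ∘ c.d.symm) (γ s)) =ᶠ[𝓝 0] fun _ => H n := by
    filter_upwards [isOpen_Ioo.mem_nhds (show (0 : ℝ) ∈ Ioo (-δ) δ by simp [hδ])] with s hs
    exact (hH _ _ (hleaf s hs)).symm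
  have hHd : DifferentiableAt ℝ (H ∘ c.d.symm) (γ 0) := by
    rw [hγ0]
    exact (contDiffAt_comp_chart_symm c.hd hnd H.contMDiff.contMDiffAt).differentiableAt (by simp)
  have h6 : HasDerivAt (fun s => (H ∘ c.d.symm) (γ s))
      (fderiv ℝ (H ∘ c.d.symm) (γ 0) (Y (γ 0))) 0 :=
    hHd.hasFDerivAt.comp_hasDerivAt 0 (hγ 0 (by simp [hδ])).2
  have h7 := h6.deriv
  rw [hconst.deriv_eq, deriv_const, hγ0, hYu] at h7
  rw [dAt_eq c.hd hnd]
  exact h7.symm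

end Characteristics

/-! ### Extending the quadratic function from Q' to Z'. -/

section QuadraticExtension

variable {E : Type*} [NormedAddCommGroup E] [NormedSpace ℝ E]
  {M : Type*} [TopologicalSpace M] [ChartedSpace E M]
  {E' : Type*} [NormedAddCommGroup E'] [NormedSpace ℝ E']
  {N : Type*} [TopologicalSpace N] [ChartedSpace E' N]
  {EX : Type*} [NormedAddCommGroup EX] [NormedSpace ℝ EX]
  {X : Type*} [TopologicalSpace X] [ChartedSpace EX X]

theorem tangentAt_comp (ι : SmoothMap E' N E M) (ψ : SmoothMap EX X E' N) (x : X)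
    (ξ : TangentSpace 𝓘(ℝ, EX) x) :
    tangentAt (ι.comp ψ) x ξ = tangentAt ι (ψ x) (tangentAt ψ x ξ) :=
  congrArg (fun L => L ξ) (mfderiv_comp x (ι.contMDiff.mdifferentiableAt (x := ψ x) (by simp))
    (ψ.contMDiff.mdifferentiableAt (x := x) (by simp)))

variable [IsManifold 𝓘(ℝ, E) ∞ M]

/-- The difference of the two values is the Hessian of `u - v` against `u` plus that against `v`,
and `u - v` is tangent to `X`. -/
theorem hessAt_eq_of_normalClass_eq {φ : SmoothMap EX X E M} {H : SmoothFn E M} {x : X}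
    (h0 : ∀ᶠ y in 𝓝 x, dAt H (φ y) = 0) {u v : TangentSpace 𝓘(ℝ, E) (φ x)}
    (huv : normalClass φ x u = normalClass φ x v) :
    hessAt H (φ x) u u = hessAt H (φ x) v v := by
  have h1 : u - v ∈ tangentRange φ x := (Submodule.Quotient.eq _).1 huv
  have h2 := hessAt_tangent_left φ H h0 h1
  have h3 : hessAt H (φ x) u u - hessAt H (φ x) v v
      = hessAt H (φ x) (u - v) u + hessAt H (φ x) (u - v) v := by
    have h4 := hessAt_symm H v u
    rw [map_sub, _root_.sub_apply, _root_.sub_apply, h4]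
    ring
  rwa [h2, h2, add_zero, sub_eq_zero] at h3

variable [FiniteDimensional ℝ E] [T2Space M] [IsManifold 𝓘(ℝ, E') ∞ N]
  [FiniteDimensional ℝ EX] [IsManifold 𝓘(ℝ, EX) ∞ X] [T2Space X] [SigmaCompactSpace X]

/-- The quadratic function on `TN|_X / TX` defined by the second derivative of a function on the
submanifold `N` extends to a smooth function on `TM|_X / TX`. -/
theorem exists_extension_verticalJet_bar {ι : SmoothMap E' N E M} (hι : IsSubmanifold ι)
    (ψ : SmoothMap EX X E' N) (H : SmoothFn E' N) (h0 : ∀ x, dAt H (ψ x) = 0) :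
    ∃ F, IsSmoothOnNormal (ι.comp ψ) F ∧
      ∀ t, F (normalInclusion ι ψ t) = (verticalJet ψ H h0).bar t := by
  have hloc : ∀ x, ∃ (g : SmoothFn E M) (O : Set X), IsOpen O ∧ x ∈ O ∧
      (∀ y ∈ O, ∀ᶠ q in 𝓝 (ψ y), g (ι q) = H q) ∧ ∀ y ∈ O, dAt g (ι (ψ y)) = 0 := by
    intro x
    obtain ⟨g, hg1, hg2, -⟩ := hι.exists_extension (ψ x) H
    have hψ : ContinuousAt ψ x := ψ.contMDiff.continuous.continuousAt
    obtain ⟨O, hO, hOo, hxO⟩ := eventually_nhds_iff.1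
      ((hψ.eventually hg1.eventually_nhds).and (hψ.eventually hg2))
    exact ⟨g, O, hOo, hxO, fun y hy => (hO y hy).1, fun y hy => (hO y hy).2 (h0 y)⟩
  choose g O hOo hxO hgH hg0 using hloc
  obtain ⟨χ, hχ⟩ := SmoothPartitionOfUnity.exists_isSubordinate 𝓘(ℝ, EX) (s := univ)
    isClosed_univ O hOo fun x _ => mem_iUnion.2 ⟨x, hxO x⟩
  have hg0' : ∀ {i x}, x ∈ O i → ∀ᶠ y in 𝓝 x, dAt (g i) (ι.comp ψ y) = 0 := by
    intro i x hx
    filter_upwards [(hOo i).mem_nhds hx] with y hy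
    exact hg0 i y hy
  have hmem : ∀ {i x}, χ i x ≠ 0 → x ∈ O i := fun {i x} h => hχ i (subset_tsupport _ h)
  have hout : ∀ i x (u : TangentSpace 𝓘(ℝ, E) (ι.comp ψ x)),
      χ i x * hessAt (g i) (ι.comp ψ x) (normalClass (ι.comp ψ) x u).out
          (normalClass (ι.comp ψ) x u).out
        = χ i x * hessAt (g i) (ι.comp ψ x) u u := by
    intro i x u
    by_cases h : χ i x = 0
    · rw [h, zero_mul, zero_mul]
    · exact congrArg (χ i x * ·) (hessAt_eq_of_normalClass_eq (hg0' (hmem h)) (Quotient.out_eq' _))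
  -- Outside `O i` the Hessian of `g i` need not descend to the quotient, so an arbitrary
  -- representative is inserted; by `hout` the weighted term does not depend on it.
  refine ⟨fun t => ∑ᶠ i, χ i t.1 * hessAt (g i) (ι.comp ψ t.1) t.2.out t.2.out, ?_, ?_⟩
  · have hπ : ContMDiff (𝓘(ℝ, EX).prod 𝓘(ℝ, E)) 𝓘(ℝ, EX) ∞
        (fun p : RestrictedTangent (ι.comp ψ) => p.1) :=
      contMDiff_proj (ι.comp ψ *ᵖ (TangentSpace 𝓘(ℝ, E) : M → Type _))
    have hterm : (fun p : RestrictedTangent (ι.comp ψ) => ∑ᶠ i, χ i p.1 *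
        hessAt (g i) (ι.comp ψ p.1) (normalClass (ι.comp ψ) p.1 p.2).out
          (normalClass (ι.comp ψ) p.1 p.2).out)
        = fun p => ∑ᶠ i, χ i p.1 * hessAt (g i) (ι.comp ψ p.1) p.2 p.2 :=
      funext fun p => finsum_congr fun i => hout i p.1 p.2
    change ContMDiff _ _ _ (fun p : RestrictedTangent (ι.comp ψ) => ∑ᶠ i, χ i p.1 *
        hessAt (g i) (ι.comp ψ p.1) (normalClass (ι.comp ψ) p.1 p.2).out
          (normalClass (ι.comp ψ) p.1 p.2).out)
    rw [hterm]
    refine contMDiff_finsum (fun i p => ?_) ?_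
    · by_cases hp : p.1 ∈ tsupport (χ i)
      · exact ((χ i).contMDiff.contMDiffAt.comp p hπ.contMDiffAt).mul
          (contMDiffAt_hessAt (g i) (hg0' (hχ i hp)))
      · refine (contMDiffAt_const (c := (0 : ℝ))).congr_of_eventuallyEq ?_
        filter_upwards [hπ.continuous.continuousAt.eventually
          (notMem_tsupport_iff_eventuallyEq.1 hp)] with q hq
        have hq' : χ i q.1 = 0 := hq
        rw [hq', zero_mul]
    · refine (χ.locallyFinite.preimage_continuous hπ.continuous).subset fun i p hp => ?_
      exact left_ne_zero_of_mul hp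
  · rintro ⟨x, u⟩
    induction u using Submodule.Quotient.induction_on with | H u =>
    change ∑ᶠ i, χ i x * hessAt (g i) (ι.comp ψ x)
      (normalClass (ι.comp ψ) x (tangentAt ι (ψ x) u)).out
      (normalClass (ι.comp ψ) x (tangentAt ι (ψ x) u)).out = hessAt H (ψ x) u u
    have hval : ∀ i, χ i x * hessAt (g i) (ι.comp ψ x)
        (normalClass (ι.comp ψ) x (tangentAt ι (ψ x) u)).out
        (normalClass (ι.comp ψ) x (tangentAt ι (ψ x) u)).out
        = χ i x * hessAt H (ψ x) u u := by
      intro i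
      by_cases h : χ i x = 0
      · rw [h, zero_mul, zero_mul]
      · refine (hout i x (tangentAt ι (ψ x) u)).trans (congrArg (χ i x * ·) ?_)
        exact (hessAt_map ι (g i) H ((hgH i x (hmem h)).mono fun q hq => hq.symm)
          (hg0 i x (hmem h)) u u).symm
    rw [finsum_congr hval, ← finsum_mul, χ.sum_eq_one (mem_univ x), one_mul]

end QuadraticExtension

/-! ### The quadratic function lies in the idealizer. -/

section Admissible

variable {E : Type*} [NormedAddCommGroup E] [NormedSpace ℝ E] [FiniteDimensional ℝ E]
  {M : Type*} [TopologicalSpace M] [ChartedSpace E M] [IsManifold 𝓘(ℝ, E) ∞ M] [T2Space M]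
  {E' : Type*} [NormedAddCommGroup E'] [NormedSpace ℝ E']
  {N : Type*} [TopologicalSpace N] [ChartedSpace E' N]
  {EX : Type*} [NormedAddCommGroup EX] [NormedSpace ℝ EX]
  {X : Type*} [TopologicalSpace X] [ChartedSpace EX X]
  {w : PoissonStructure E M} {ι : SmoothMap E' N E M} {ψ : SmoothMap EX X E' N}

omit [FiniteDimensional ℝ E] [IsManifold 𝓘(ℝ, E) ∞ M] [T2Space M] in
theorem dAt_mem_annihilator {φ : SmoothMap EX X E M} {f : SmoothFn E M} (hf : f ∈ constraints φ)
    (x : X) : dAt f (φ x) ∈ annihilator φ x := by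
  rintro _ ⟨v, rfl⟩
  rw [dAt_tangentAt (ι := φ) f 0 (Eventually.of_forall hf) v]
  have h : dAt (0 : SmoothFn EX X) x = 0 := mfderiv_const
  rw [h]; rfl

omit [IsManifold 𝓘(ℝ, E) ∞ M] [T2Space M] in
-- Chart form of coisotropy: forms killing the range of `c.B` are conormal, so their images are
-- tangent to `N`. The conormal `β` is recorded so that invariance of `H` can be applied to `v`.
theorem SliceChart.coord_bivector {n : N} (c : SliceChart ι n) (hco : IsCoisotropic w ι) {n' : N}
    (hn : ι n' ∈ c.e.source) {α : E →L[ℝ] ℝ} (hα : ∀ v, α (c.B v) = 0) :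
    ∃ v, w.coord c.e (c.e (ι n')) α = c.B (dChart c.d n' v) ∧
      ∃ β ∈ annihilator ι n', tangentAt ι n' v = w.sharp (ι n') β := by
  have hβ : α.comp (dChart c.e (ι n')) ∈ annihilator ι n' := by
    rintro _ ⟨v, rfl⟩
    rw [ContinuousLinearMap.comp_apply, c.dChart_tangentAt hn, hα]
  obtain ⟨v, hv⟩ := hco.sharp_mem_tangentRange hβ
  exact ⟨v, by rw [w.coord_apply hn, ← hv, c.dChart_tangentAt hn], _, hβ, hv⟩

omit [FiniteDimensional ℝ E] [IsManifold 𝓘(ℝ, E) ∞ M] [T2Space M] in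
theorem SliceChart.toNormal_frameMap {x : X} (c : SliceChart ι (ψ x)) {x' : X}
    (hx' : ι (ψ x') ∈ c.e.source) (v : E') :
    toNormal (ι.comp ψ) (frameMap (ι.comp ψ) c.e (x', c.B v))
      = normalInclusion ι ψ ⟨x', normalClass ψ x' (dChartInv c.d (ψ x') v)⟩ :=
  congrArg (fun u => (⟨x', normalClass (ι.comp ψ) x' u⟩ : NormalBundle (ι.comp ψ)))
    (c.tangentAt_dChartInv hx' v).symm

omit [FiniteDimensional ℝ E] [T2Space M] in
/-- If a function on the normal bundle of `X` in `M` restricts on the normal bundle of `X` in `N`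
to the quadratic function of a field `D` of symmetric forms, then the functions `f` and `h` which
represent its differential at a normal vector tangent to `N` have these derivatives along `N`. -/
theorem SliceChart.fderiv_of_sameDifferential {x : X} (c : SliceChart ι (ψ x))
    {F : NormalBundle (ι.comp ψ) → ℝ} (hF : IsSmoothOnNormal (ι.comp ψ) F)
    {D : E' → E' →L[ℝ] E' →L[ℝ] ℝ} (hD : DifferentiableAt ℝ D (c.d (ψ x)))
    (hsymm : ∀ u v, D (c.d (ψ x)) u v = D (c.d (ψ x)) v u)
    (hFD : ∀ x' v, ι (ψ x') ∈ c.e.source →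
      F (toNormal (ι.comp ψ) (frameMap (ι.comp ψ) c.e (x', c.B v))) = D (c.d (ψ x')) v v)
    (u : TangentSpace 𝓘(ℝ, E') (ψ x)) {f h : SmoothFn E M}
    (hfh : SameDifferential (ι.comp ψ) F ⟨x, tangentAt ι (ψ x) u⟩ f h) :
    h ∈ constraints (ι.comp ψ) ∧
    (∀ v, fderiv ℝ (h ∘ c.e.symm) (c.B (c.d (ψ x))) (c.B v)
      = 2 * D (c.d (ψ x)) (dChart c.d (ψ x) u) v) ∧
    ∀ ξ, fderiv ℝ (f ∘ c.e.symm) (c.B (c.d (ψ x))) (c.B (dChart c.d (ψ x) (tangentAt ψ x ξ)))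
      + fderiv ℝ (fderiv ℝ (h ∘ c.e.symm)) (c.B (c.d (ψ x)))
        (c.B (dChart c.d (ψ x) (tangentAt ψ x ξ))) (c.B (dChart c.d (ψ x) u))
      = fderiv ℝ (fun y => D y (dChart c.d (ψ x) u) (dChart c.d (ψ x) u)) (c.d (ψ x))
        (dChart c.d (ψ x) (tangentAt ψ x ξ)) := by
  have hx := c.mem
  obtain ⟨hh, h1, h2⟩ := (sameDifferential_iff c.he hx hF f h).1 hfh
  have hp : fibreCoord (ι.comp ψ) c.e ⟨x, tangentAt ι (ψ x) u⟩ = c.B (dChart c.d (ψ x) u) :=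
    c.dChart_tangentAt hx u
  have hz : c.e (ι.comp ψ x) = c.B (c.d (ψ x)) := c.map_eq (ψ x) hx
  have hξ : ∀ ξ, dChart c.e (ι.comp ψ x) (tangentAt (ι.comp ψ) x ξ)
      = c.B (dChart c.d (ψ x) (tangentAt ψ x ξ)) := fun ξ =>
    (congrArg (dChart c.e (ι (ψ x))) (tangentAt_comp ι ψ x ξ)).trans (c.dChart_tangentAt hx _)
  simp only [hp, hz, hξ] at h1 h2
  refine ⟨hh, fun v => ?_, fun ξ => (h1 ξ).trans ?_⟩
  · rw [h2]
    have h3 := fderiv_comp (dChart c.d (ψ x) u)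
      (differentiableAt_frameMap hF c.he hx (c.B (dChart c.d (ψ x) u))) c.B.differentiableAt
    have h4 : (fun v => F (toNormal (ι.comp ψ) (frameMap (ι.comp ψ) c.e (x, v)))) ∘ c.B
        = fun v => D (c.d (ψ x)) v v := funext fun v => hFD x v hx
    have h5 : HasFDerivAt (fun v => D (c.d (ψ x)) v v) _ (dChart c.d (ψ x) u) :=
      (D (c.d (ψ x))).hasFDerivAt.clm_apply (hasFDerivAt_id (dChart c.d (ψ x) u))
    rw [h4, h5.fderiv, c.B.fderiv] at h3
    refine (DFunLike.congr_fun h3 v).symm.trans ?_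
    -- Symmetry of the form merges the two terms of the product rule into the factor 2.
    simp [hsymm v]
    ring
  · have h3 : (fun y => F (toNormal (ι.comp ψ)
        (frameMap (ι.comp ψ) c.e (y, c.B (dChart c.d (ψ x) u))))) =ᶠ[𝓝 x]
        fun y => (fun y' => D y' (dChart c.d (ψ x) u) (dChart c.d (ψ x) u)) (c.d (ψ y)) := by
      filter_upwards [(ι.comp ψ).contMDiff.continuous.continuousAt.preimage_mem_nhds
        (c.e.open_source.mem_nhds hx)] with y hy
      exact hFD y _ hy
    rw [dFun_congr h3]
    exact dFun_comp_chart c.hd (c.mem_source _ hx)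
      ((hD.clm_apply (differentiableAt_const _)).clm_apply (differentiableAt_const _)) ξ

variable [IsManifold 𝓘(ℝ, E') ∞ N]

/-- Translation into a slice chart, where `linearized_bracket_eq_zero` applies. It treats every
choice of representatives at once, provided the base vector is tangent to `N`. -/
theorem swBracket_value_eq_zero (hι : IsSubmanifold ι) (hLag : IsLagrangian w (ι.comp ψ))
    (hco : IsCoisotropic w ι) {H : SmoothFn E' N} (h0 : ∀ x, dAt H (ψ x) = 0)
    (hH : IsAnnihilatedBySubcharacteristic w ι H) {F G : NormalBundle (ι.comp ψ) → ℝ}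
    (hF : IsSmoothOnNormal (ι.comp ψ) F)
    (hFH : ∀ t, F (normalInclusion ι ψ t) = (verticalJet ψ H h0).bar t)
    (hG : G ∈ swConstraints ι ψ) {x : X} {u : TangentSpace 𝓘(ℝ, E') (ψ x)} {f h g k : SmoothFn E M}
    (hfh : SameDifferential (ι.comp ψ) F ⟨x, tangentAt ι (ψ x) u⟩ f h)
    (hgk : SameDifferential (ι.comp ψ) G ⟨x, tangentAt ι (ψ x) u⟩ g k) :
    w.bracket f k (ι (ψ x)) + w.bracket h g (ι (ψ x))
      + dAt (w.bracket h k) (ι (ψ x)) (tangentAt ι (ψ x) u) = 0 := by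
  obtain ⟨c⟩ := hι.exists_sliceChart (ψ x)
  have hx := c.mem
  have hn := c.mem_source _ hx
  have hz : c.e (ι (ψ x)) = c.B (c.d (ψ x)) := c.map_eq (ψ x) hx
  have hHs := contDiffAt_comp_chart_symm c.hd hn H.contMDiff.contMDiffAt
  have hHc : ∀ {x'}, ι (ψ x') ∈ c.e.source → fderiv ℝ (H ∘ c.d.symm) (c.d (ψ x')) = 0 := by
    intro x' hx'
    ext v
    rw [← dAt_dChartInv c.hd (c.mem_source _ hx'), h0]
    rfl
  obtain ⟨hh, hF1, hF2⟩ := c.fderiv_of_sameDifferential hF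
    (D := fderiv ℝ (fderiv ℝ (H ∘ c.d.symm)))
    ((contDiffAt_fderiv (contDiffAt_fderiv hHs)).differentiableAt (by simp))
    (fderiv_fderiv_symm (hHs.of_le two_le_infty))
    (fun x' v hx' => by
      rw [c.toNormal_frameMap hx', hFH]
      refine (hessAt_eq_chart c.hd (c.mem_source _ hx') H (h0 x') _ _).trans ?_
      rw [dChart_dChartInv c.hd (c.mem_source _ hx')]) u hfh
  -- A constraint restricts to the quadratic function of the zero form.
  obtain ⟨hk, hG1, hG2⟩ := c.fderiv_of_sameDifferential hG.1
    (D := fun _ => 0) (differentiableAt_const _) (fun _ _ => rfl)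
    (fun x' v hx' => by
      rw [c.toNormal_frameMap hx', hG.2]; rfl) u hgk
  have hO : ∀ᶠ y in 𝓝 (c.d (ψ x)), y ∈ c.d.target ∧ ι (c.d.symm y) ∈ c.e.source := by
    refine (c.d.symm.isOpen_inter_preimage
      (c.e.open_source.preimage ι.contMDiff.continuous)).mem_nhds ⟨c.d.map_source hn, ?_⟩
    change ι (c.d.symm (c.d (ψ x))) ∈ c.e.source
    rwa [c.d.left_inv hn]
  have hBy : ∀ y, y ∈ c.d.target ∧ ι (c.d.symm y) ∈ c.e.source →
      c.B y = c.e (ι (c.d.symm y)) := by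
    intro y hy
    rw [c.map_eq _ hy.2, c.d.right_inv hy.1]
  -- The Lagrangian condition enters here: Hamiltonian vectors of functions vanishing on `X` are
  -- tangent to `X`.
  have htang : ∀ f ∈ constraints (ι.comp ψ), ∃ ξ, w.coord c.e (c.B (c.d (ψ x)))
      (fderiv ℝ (f ∘ c.e.symm) (c.B (c.d (ψ x))))
        = c.B (dChart c.d (ψ x) (tangentAt ψ x ξ)) := by
    intro f hf
    obtain ⟨ξ, hξ⟩ := (hLag x (dAt f (ι.comp ψ x))).2 (dAt_mem_annihilator hf x)
    refine ⟨ξ, ?_⟩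
    rw [← hz, ← w.dChart_ham c.he hx, ← c.dChart_tangentAt hx, ← tangentAt_comp]
    exact congrArg (dChart c.e (ι (ψ x))) hξ.symm
  obtain ⟨ξ₁, hξ₁⟩ := htang k hk
  obtain ⟨ξ₂, hξ₂⟩ := htang h hh
  have hs : ∀ f : SmoothFn E M, ContDiffAt ℝ ∞ (f ∘ c.e.symm) (c.B (c.d (ψ x))) := fun f => by
    rw [← hz]; exact contDiffAt_comp_chart_symm c.he hx f.contMDiff.contMDiffAt
  have key := linearized_bracket_eq_zero (A := c.A) (B := c.B) (P := w.coord c.e)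
    (H := H ∘ c.d.symm) (y₀ := c.d (ψ x)) (f := f ∘ c.e.symm) (h := h ∘ c.e.symm)
    (g := g ∘ c.e.symm) (k := k ∘ c.e.symm) c.hAB (hz ▸ w.contDiffAt_coord c.he hx) hHs (hHc hx)
    (Eventually.of_forall fun y α β => w.coord_skew α β)
    (hO.mono fun y hy α β hα hβ => by
      obtain ⟨v, hv, -⟩ := c.coord_bivector hco hy.2 hβ
      rw [hBy y hy, hv, hα])
    (hO.mono fun y hy α hα => by
      obtain ⟨v, hv, β, hβ, hvβ⟩ := c.coord_bivector hco hy.2 hα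
      have h1 := dAt_eq c.hd (c.d.map_target hy.1) H v
      rw [c.d.right_inv hy.1, hH _ β hβ v hvβ] at h1
      rw [hBy y hy, hv, c.hAB]
      exact h1.symm)
    (hs h) (hs k) (dChart c.d (ψ x) u) (T := {b | ∃ ξ, b = dChart c.d (ψ x) (tangentAt ψ x ξ)})
    hF1 (by rintro _ ⟨ξ, rfl⟩; exact hF2 ξ)
    (fun v => (hG1 v).trans (by simp))
    (by rintro _ ⟨ξ, rfl⟩; refine (hG2 ξ).trans ?_; simp)
    ⟨ξ₁, rfl⟩ ⟨ξ₂, rfl⟩ hξ₁ hξ₂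
  have hbr : (w.bracket h k ∘ c.e.symm) =ᶠ[𝓝 (c.e (ι (ψ x)))] fun z =>
      fderiv ℝ (h ∘ c.e.symm) z (w.coord c.e z (fderiv ℝ (k ∘ c.e.symm) z)) := by
    filter_upwards [c.e.open_target.mem_nhds (c.e.map_source hx)] with z hz
    have h1 := w.bracket_eq c.he (c.e.map_target hz) h k
    rwa [c.e.right_inv hz] at h1
  rw [w.bracket_eq c.he hx, w.bracket_eq c.he hx, dAt_eq c.he hx, hbr.fderiv_eq,
    c.dChart_tangentAt hx, hz]
  exact key

theorem mem_swAdmissible (hι : IsSubmanifold ι) (hψ : ∀ x, Function.Injective (tangentAt ψ x))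
    (hcon : HasConormalFunctions (ι.comp ψ)) (hLag : IsLagrangian w (ι.comp ψ))
    (hco : IsCoisotropic w ι) {H : SmoothFn E' N} (h0 : ∀ x, dAt H (ψ x) = 0)
    (hH : IsAnnihilatedBySubcharacteristic w ι H) {F : NormalBundle (ι.comp ψ) → ℝ}
    (hF : IsSmoothOnNormal (ι.comp ψ) F)
    (hFH : ∀ t, F (normalInclusion ι ψ t) = (verticalJet ψ H h0).bar t) :
    F ∈ swAdmissible w ι ψ := by
  refine ⟨hF, fun G hG => ?_⟩
  rintro ⟨x, u⟩
  induction u using Submodule.Quotient.induction_on with | H u =>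
  have hinj : ∀ x, Function.Injective (tangentAt (ι.comp ψ) x) := by
    intro x ξ η h
    refine hψ x (hι.tangentAt_injective (ψ x) ?_)
    rw [← tangentAt_comp, ← tangentAt_comp]
    exact h
  obtain ⟨f, h, hfh⟩ := exists_sameDifferential hcon hinj hF ⟨x, tangentAt ι (ψ x) u⟩
  obtain ⟨g, k, hgk⟩ := exists_sameDifferential hcon hinj hG.1 ⟨x, tangentAt ι (ψ x) u⟩
  -- Existence of representatives makes the chosen value one of the bracket formulas. Each of these
  -- vanishes, so independence of the choices needs no separate argument.
  obtain ⟨⟨x', v⟩, f, h, g, k, hp, hfh, hgk, hc⟩ := Classical.epsilon_spec (p := fun c : ℝ =>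
    ∃ (p : RestrictedTangent (ι.comp ψ)) (f h g k : SmoothFn E M),
      toNormal (ι.comp ψ) p = normalInclusion ι ψ ⟨x, Submodule.Quotient.mk u⟩ ∧
      SameDifferential (ι.comp ψ) F p f h ∧ SameDifferential (ι.comp ψ) G p g k ∧
      c = w.bracket f k (ι.comp ψ p.1) + w.bracket h g (ι.comp ψ p.1)
        + dAt (w.bracket h k) (ι.comp ψ p.1) p.2)
    ⟨_, _, f, h, g, k, rfl, hfh, hgk, rfl⟩
  refine Eq.trans hc ?_
  obtain rfl : x' = x := congrArg Sigma.fst hp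
  have hv : normalClass (ι.comp ψ) x' v = normalClass (ι.comp ψ) x' (tangentAt ι (ψ x') u) :=
    eq_of_heq (Sigma.mk.inj hp).2
  -- The chosen representative differs from the image of `u` by a vector of TX, which lies in TN, so
  -- it is itself tangent to `N`.
  obtain ⟨ξ, hξ⟩ := (Submodule.Quotient.eq _).1 hv
  obtain rfl : v = tangentAt ι (ψ x') (u + tangentAt ψ x' ξ) := by
    rw [map_add, ← tangentAt_comp]
    exact (add_eq_of_eq_sub' hξ).symm
  exact swBracket_value_eq_zero hι hLag hco h0 hH hF hFH hG hfh hgk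

end Admissible

end SternbergWeinstein

end

/-! ### Assembly of the three assertions. -/

theorem mainTheorem5
    {EZ ES EQ EX : Type*}
    [NormedAddCommGroup EZ] [NormedSpace ℝ EZ] [FiniteDimensional ℝ EZ]
    [NormedAddCommGroup ES] [NormedSpace ℝ ES] [FiniteDimensional ℝ ES]
    [NormedAddCommGroup EQ] [NormedSpace ℝ EQ] [FiniteDimensional ℝ EQ]
    [NormedAddCommGroup EX] [NormedSpace ℝ EX] [FiniteDimensional ℝ EX]
    {Z S Q X : Type*}
    [TopologicalSpace Z] [T2Space Z] [SecondCountableTopology Z]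
    [ChartedSpace EZ Z] [IsManifold 𝓘(ℝ, EZ) ∞ Z]
    [TopologicalSpace S] [ChartedSpace ES S] [IsManifold 𝓘(ℝ, ES) ∞ S]
    [TopologicalSpace Q] [ChartedSpace EQ Q] [IsManifold 𝓘(ℝ, EQ) ∞ Q]
    [TopologicalSpace X] [ChartedSpace EX X] [IsManifold 𝓘(ℝ, EX) ∞ X]
    (w : SternbergWeinstein.PoissonStructure EZ Z)
    (iX : SternbergWeinstein.SmoothMap EX X ES S)
    (iS : SternbergWeinstein.SmoothMap ES S EQ Q)
    (iQ : SternbergWeinstein.SmoothMap EQ Q EZ Z)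
    (hX : SternbergWeinstein.IsSubmanifold iX)
    (hS : SternbergWeinstein.IsSubmanifold iS)
    (hQ : SternbergWeinstein.IsSubmanifold iQ)
    (hleaf : SternbergWeinstein.IsSymplecticLeaf w (iQ.comp iS))
    (hLag : SternbergWeinstein.IsLagrangian w (iQ.comp (iS.comp iX)))
    (hQclosed : IsLocallyClosed (Set.range iQ))
    (hQco : SternbergWeinstein.IsCoisotropic w iQ)
    (Ht : SternbergWeinstein.SmoothFn EQ Q)
    (hHt : ∀ x, SternbergWeinstein.dAt Ht (iS.comp iX x) = 0) :
    ∃ jt : SternbergWeinstein.SymmetricField (iS.comp iX),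
      (SternbergWeinstein.IsVerticalJet (iS.comp iX) Ht jt ∧
        ∀ jt' : SternbergWeinstein.SymmetricField (iS.comp iX),
          SternbergWeinstein.IsVerticalJet (iS.comp iX) Ht jt' → jt' = jt) ∧
      (∀ H : SternbergWeinstein.SmoothFn EZ Z, (∀ q, Ht q = H (iQ q)) →
        (∀ x, SternbergWeinstein.dAt H (iQ.comp (iS.comp iX) x) = 0) →
        ∃ j : SternbergWeinstein.SymmetricField (iQ.comp (iS.comp iX)),
          SternbergWeinstein.IsVerticalJet (iQ.comp (iS.comp iX)) H j ∧
          ∀ t, jt.bar t = j.bar (SternbergWeinstein.normalInclusion iQ (iS.comp iX) t)) ∧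
      (Ht ∈ SternbergWeinstein.constantOnLeaves w iQ →
        jt.bar ∈ SternbergWeinstein.swReduced w iQ (iS.comp iX)) ∧
      (Ht ∈ SternbergWeinstein.admissibleRestrictions w iQ →
        jt.bar ∈ SternbergWeinstein.swReduced w iQ (iS.comp iX)) := by
  have hSX := hS.isEmbedding.comp hX.isEmbedding
  have hQSX := hQ.isEmbedding.comp hSX
  have : T2Space Q := hQ.isEmbedding.t2Space
  have : T2Space X := hQSX.t2Space
  have : T2Space S := (hQ.isEmbedding.comp hS.isEmbedding).t2Space
  -- With local compactness this gives σ-compactness of `X`, needed for the partition of unity.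
  have : SecondCountableTopology X := hQSX.secondCountableTopology
  have : LocallyCompactSpace X := ChartedSpace.locallyCompactSpace EX X
  have hinj : ∀ x, Function.Injective (SternbergWeinstein.tangentAt (iS.comp iX) x) := by
    intro x ξ η h
    rw [SternbergWeinstein.tangentAt_comp, SternbergWeinstein.tangentAt_comp] at h
    exact hX.tangentAt_injective x (hS.tangentAt_injective (iX x) h)
  have hcon := (hX.hasConormalFunctions.comp hS).comp hQ
  have hred : SternbergWeinstein.IsAnnihilatedBySubcharacteristic w iQ Ht →
      (SternbergWeinstein.verticalJet (iS.comp iX) Ht hHt).bar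
        ∈ SternbergWeinstein.swReduced w iQ (iS.comp iX) := by
    intro h
    obtain ⟨F, hF, hFH⟩ :=
      SternbergWeinstein.exists_extension_verticalJet_bar hQ (iS.comp iX) Ht hHt
    exact ⟨F, SternbergWeinstein.mem_swAdmissible hQ hinj hcon hLag hQco hHt h hF hFH,
      fun t => (hFH t).symm⟩
  refine ⟨SternbergWeinstein.verticalJet (iS.comp iX) Ht hHt,
    ⟨SternbergWeinstein.isVerticalJet_verticalJet Ht hHt, fun jt' hjt' =>
      (SternbergWeinstein.isVerticalJet_verticalJet Ht hHt).unique hjt'⟩, ?_,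
    fun h => hred (SternbergWeinstein.isAnnihilatedBySubcharacteristic_of_constantOnLeaves
      hQ hQco h),
    fun h => hred (SternbergWeinstein.isAnnihilatedBySubcharacteristic_of_admissible hQ h)⟩
  intro H hH hH0
  refine ⟨SternbergWeinstein.verticalJet (iQ.comp (iS.comp iX)) H hH0,
    SternbergWeinstein.isVerticalJet_verticalJet H hH0, ?_⟩
  rintro ⟨x, u⟩
  induction u using Submodule.Quotient.induction_on with | H u =>
  exact SternbergWeinstein.hessAt_map iQ H Ht (Filter.Eventually.of_forall hH) (hH0 x) u u
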